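/- Let $N\ge 1$ and $w\ge 1$ be integers, put $k=w+2$ and $\zeta_N=\exp(2\pi i/N)$. **Period polynomials.** A matrix $\gamma=\left(\begin{smallmatrix}a&b\\c&d\end{smallmatrix}\right)\in \mathrm{GL}(2,\mathbb Z)$ acts on the space $V_w$ of homogeneous polynomials of degree $w$ in $\mathbb{Q}[X,Y]$ by $P|_\gamma(X,Y)=P(aX+bY,cX+dY)$. Put $\epsilon=\left(\begin{smallmatrix}-1&0\\0&1\end{smallmatrix}\right)$, $J=\left(\begin{smallmatrix}-1&0\\0&-1\end{smallmatrix}\right)$, $S=\left(\begin{smallmatrix}0&-1\\1&0\end{smallmatrix}\right)$, $U=\left(\begin{smallmatrix}1&-1\\1&0\end{smallmatrix}\right)$. For maps $P:\Gamma_1(N)\backslash \mathrm{SL}(2,\mathbb Z)\to V_w$ put $P|_\gamma(C)=P(C\gamma^{-1})|_\gamma$ for $\gamma\in\mathrm{SL}(2,\mathbb Z)$ and $P|_\epsilon(C)=P(\epsilon C\epsilon)|_\epsilon$. Let $\bar W_w^{\Gamma_1(N),+}$ be the space of those maps $P$ with $$P|_J=P,\qquad P+P|_S=0,\qquad P+P|_U+P|_{U^2}=0,\qquad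 P|_\epsilon=(-1)^wP.$$ **Coefficients.** Let $A(N)$ be the set of pairs $(a,b)\in(\mathbb Z/N\mathbb Z)^2$ with $\gcd(a,b,N)=1$; for $(a,b)\in A(N)$ let $C_{a,b}\in\Gamma_1(N)\backslash\mathrm{SL}(2,\mathbb Z)$ be the coset of the matrices with bottom row congruent to $(a,b)$ modulo $N$. For $P\in\bar W_w^{\Gamma_1(N),+}$ define $q^{r,s}_{a,b}\in\mathbb Q$ ($r,s\ge1$, $r+s=k$, $(a,b)\in A(N)$) by $$P(C_{a,-a+b})(X-Y,X)=\sum_{\substack{r+s=w\\ r,s\ge0}}\frac1{r!\,s!}\,q^{r+1,s+1}_{a,b}X^rY^s,$$ and put $$q^{r,s,\mathrm{od}}_{a,b}=\tfrac12\left(q^{r,s}_{a,b}-(-1)^r q^{r,s}_{-a,b}\right).$$ **Colored zeta values.** For $k_1,\dots,k_d\ge1$ and $N$-th roots of unity $z_1,\dots,z_d$ with $(k_d,z_d)\ne(1,1)$ let $$\zeta\binom{k_1,\dots,k_d}{z_1,\dots,z_d}=\lim_{M\to\infty}\ \sum_{0<m_1<\cdots<m_d<M}\frac{z_1^{m_1}\cdots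 z_d^{m_d}}{m_1^{k_1}\cdots m_d^{k_d}},$$ and let $\zeta^{ш}\binom{k_1,\dots,k_d}{z_1,\dots,z_d}\in\mathbb C[T]$ be the shuffle regularized values: the unique extension of these numbers to all indices that is multiplicative for the shuffle product (of the words of the corresponding iterated integrals) and satisfies $\zeta^{ш}\binom{1}{1}=T$. **Statement.** For every $P\in\bar W_w^{\Gamma_1(N),+}$ the element $$\sum_{\substack{r+s=k\\ r,s\ge1}}\ \sum_{(a,b)\in A(N)}q^{r,s,\mathrm{od}}_{a,b}\ \zeta^{ш}\binom{r,s}{\zeta_N^a,\zeta_N^b}$$ of $\mathbb C[T]$ is a constant, and this constant belongs to $\mathbb Q\cdot(2\pi i)^k$. -/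

import Mathlib

open scoped Nat Polynomial MatrixGroups

noncomputable section

namespace ColoredDoubleZeta

/-! ### Period polynomials of a subgroup of `SL(2, ℤ)` -/

/-- The right action `P(X, Y) ↦ P(aX + bY, cX + dY)` of a `2 × 2` integer matrix `(a b; c d)` on
polynomials in `X = X 0` and `Y = X 1`. -/
def slash (γ : Matrix (Fin 2) (Fin 2) ℤ) (P : MvPolynomial (Fin 2) ℚ) : MvPolynomial (Fin 2) ℚ :=
  MvPolynomial.aeval
    (fun i => MvPolynomial.C (γ i 0 : ℚ) * MvPolynomial.X 0 +
      MvPolynomial.C (γ i 1 : ℚ) * MvPolynomial.X 1) P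

/-- The matrix `U = (1 -1; 1 0)`. The matrix `S = (0 -1; 1 0)` is `ModularGroup.S`, and `J` is
`-1`. -/
def U : SL(2, ℤ) := ⟨!![1, -1; 1, 0], by simp [Matrix.det_fin_two]⟩

/-- The matrix `ε = (-1 0; 0 1)`, of determinant `-1`. -/
def eps : Matrix (Fin 2) (Fin 2) ℤ := !![-1, 0; 0, 1]

/-- Conjugation `g ↦ ε g ε` on `SL(2, ℤ)`. -/
def epsConj (g : SL(2, ℤ)) : SL(2, ℤ) :=
  ⟨eps * (g : Matrix (Fin 2) (Fin 2) ℤ) * eps, by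
    rw [Matrix.det_mul, Matrix.det_mul, g.det_coe]; simp [eps, Matrix.det_fin_two]⟩

/-- `(P|γ)(C) = P(C γ⁻¹)|γ` for `γ ∈ SL(2, ℤ)`. -/
def slashSL (P : SL(2, ℤ) → MvPolynomial (Fin 2) ℚ) (γ : SL(2, ℤ)) :
    SL(2, ℤ) → MvPolynomial (Fin 2) ℚ :=
  fun g => slash (γ : Matrix (Fin 2) (Fin 2) ℤ) (P (g * γ⁻¹))

/-- `(P|ε)(C) = P(ε C ε)|ε`. -/
def slashEps (P : SL(2, ℤ) → MvPolynomial (Fin 2) ℚ) : SL(2, ℤ) → MvPolynomial (Fin 2) ℚ :=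
  fun g => slash eps (P (epsConj g))

/-- The maps from `Γ \ SL(2, ℤ)` to the homogeneous polynomials of degree `w`, written as left
`Γ`-invariant functions on `SL(2, ℤ)`, that are fixed by `J = -1`. -/
def V (Γ : Subgroup SL(2, ℤ)) (w : ℕ) : Set (SL(2, ℤ) → MvPolynomial (Fin 2) ℚ) :=
  {P | (∀ g, (P g).IsHomogeneous w) ∧ (∀ γ ∈ Γ, ∀ g, P (γ * g) = P g) ∧ slashSL P (-1) = P}

/-- Period polynomials: `P|(1 + S) = P|(1 + U + U²) = 0`. -/
def W (Γ : Subgroup SL(2, ℤ)) (w : ℕ) : Set (SL(2, ℤ) → MvPolynomial (Fin 2) ℚ) :=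
  {P | P ∈ V Γ w ∧ P + slashSL P ModularGroup.S = 0 ∧
    P + slashSL P U + slashSL P (U ^ 2) = 0}

/-- The eigenspace of `ε` in `W` for the eigenvalue `σ = ±1`. -/
def WSign (Γ : Subgroup SL(2, ℤ)) (w : ℕ) (σ : ℤˣ) : Set (SL(2, ℤ) → MvPolynomial (Fin 2) ℚ) :=
  {P | P ∈ W Γ w ∧ slashEps P = (σ : ℤ) • P}

/-- `WBar` with sign `σ`: the `σ`-eigenspace for even `w`, the `-σ`-eigenspace for odd `w`. -/
def WBar (Γ : Subgroup SL(2, ℤ)) (w : ℕ) (σ : ℤˣ) : Set (SL(2, ℤ) → MvPolynomial (Fin 2) ℚ) :=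
  if Even w then WSign Γ w σ else WSign Γ w (-σ)

/-! ### The index set and the odd part of the coefficients -/

/-- The pairs `(a, b)` in `ℤ/Nℤ` with `gcd(a, b, N) = 1`. -/
def A (N : ℕ) [NeZero N] : Finset (ZMod N × ZMod N) :=
  Finset.univ.filter fun p => Nat.gcd (Nat.gcd p.1.val p.2.val) N = 1

/-- `q^{r,s,od}_{a,b} = (q^{r,s}_{a,b} - (-1)^r q^{r,s}_{-a,b}) / 2`. -/
def qOdd {N : ℕ} (q : ℕ → ℕ → ZMod N → ZMod N → ℚ) (r s : ℕ) (a b : ZMod N) : ℚ :=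
  (q r s a b - (-1) ^ r * q r s (-a) b) / 2

/-! ### Colored multiple zeta values and their shuffle regularization

An index `(k₁, …, k_d; ζ_N^{a₁}, …, ζ_N^{a_d})` is the list `[(k₁, a₁), …, (k_d, a_d)]`. -/

/-- `ζ_N^a` with `ζ_N = exp(2πi/N)`. -/
def zetaN (N : ℕ) (a : ZMod N) : ℂ :=
  Complex.exp (2 * Real.pi * Complex.I / N) ^ a.val

/-- The sum of `∏ z_i^{m_i} / m_i^{k_i}` over `0 < m₁ < ⋯ < m_d < M`, where the list is read from
the outermost entry `(k_d, a_d)` to the innermost entry `(k₁, a₁)`. -/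
def truncSum (N : ℕ) : List (ℕ × ZMod N) → ℕ → ℂ
  | [], _ => 1
  | (k, a) :: l, M => ∑ m ∈ Finset.Ico 1 M, zetaN N a ^ m / (m : ℂ) ^ k * truncSum N l m

/-- The series `ζ(k₁, …, k_d; z₁, …, z_d)`, convergent for `(k_d, z_d) ≠ (1, 1)`; the list is read
from `(k_d, a_d)` to `(k₁, a₁)`. -/
def zetaRev (N : ℕ) (l : List (ℕ × ZMod N)) : ℂ :=
  Filter.limUnder Filter.atTop (truncSum N l)

/-- Letters of the iterated integrals on `[0, 1]`: `none` is the form `dt/t`, and `some a` is the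
form `η dt/(1 - η t)` with `η = ζ_N^a`. Words are read from the variable nearest to `1` down to the
one nearest to `0`, so a word diverges at `1` exactly if its first letter is `some 0`. -/
abbrev Letter (N : ℕ) := Option (ZMod N)

/-- The word of the iterated integral of an index, read from `(k_d, a_d)` to `(k₁, a₁)`: the index
`(k, a)` gives `k - 1` letters `dt/t`, then the letter of the root of unity `z_i z_{i+1} ⋯ z_d`
(the argument `c` collects the exponents read so far). -/
def toWord {N : ℕ} : ZMod N → List (ℕ × ZMod N) → List (Letter N)
  | _, [] => []
  | c, (k, a) :: l => List.replicate (k - 1) none ++ some (c + a) :: toWord (c + a) l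

/-- The inverse of `toWord` on words whose last letter is not `dt/t` (`k` is one more than the
number of letters `dt/t` read since the last other letter). -/
def ofWord {N : ℕ} : ZMod N → ℕ → List (Letter N) → List (ℕ × ZMod N)
  | _, _, [] => []
  | c, k, none :: l => ofWord c (k + 1) l
  | c, k, some a :: l => (k, a - c) :: ofWord a 1 l

/-- The shuffle regularized value in `ℂ[T]` of the word `e₁ⁿ u`, where `e₁ = some 0` is the form
`dt/(1 - t)` and the word `u` does not begin with `e₁`. For `n = 0` it is the convergent value.
Otherwise it is forced by multiplicativity for the shuffle product and `e₁ ↦ T`: writing `u = x v`,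
`e₁ ⧢ (e₁ⁿ u) = (n + 1) e₁ⁿ⁺¹ u + e₁ⁿ x (e₁ ⧢ v)`,
where `x (e₁ ⧢ v)` is the sum over the insertions of `e₁` into `u` behind its first letter. -/
def shuffleReg (N : ℕ) : ℕ → List (Letter N) → ℂ[X]
  | 0, u => Polynomial.C (zetaRev N (ofWord 0 1 u))
  | n + 1, u => Polynomial.C (1 / ((n : ℂ) + 1)) *
      (Polynomial.X * shuffleReg N n u -
        ∑ i ∈ Finset.range u.length, shuffleReg N n (u.insertIdx (i + 1) (some 0)))

/-- The shuffle regularized colored multiple zeta value in `ℂ[T]` of the index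
`[(k₁, a₁), …, (k_d, a_d)]`. -/
def shuffleZeta (N : ℕ) (l : List (ℕ × ZMod N)) : ℂ[X] :=
  let u := toWord 0 l.reverse
  shuffleReg N (u.takeWhile fun x => decide (x = some 0)).length
    (u.dropWhile fun x => decide (x = some 0))

end ColoredDoubleZeta

end

/-! Let p(c, d) be the value of P on the coset with bottom row (-d, c). The action on cosets then
becomes the linear substitution in (c, d), simultaneous with that in (X, Y). In these terms p is
invariant under -1 and ε, changes sign when the coordinates are exchanged, and satisfies p + p|U +
p|U² = 0. Up to the sign (-1)^w and factorials, the numbers q^{r,s,od} are the coefficients of the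
ε-invariant part of p|U, called `oddPart`.

Let D(f) be the pairing of f with the double sums over 0 < m < n < M. If f is symmetric under
exchange, two truncated products compute D. The stuffle product says that the sum over the square m,
n < M is 2 D(f) plus a diagonal. Partial fractions say that the sum over the triangle m + n < M is 2
D(f|T), with T = (1 1; 0 1). The period relations give oddPart = 2/3 (s - s|T) - 1/3 e, where s =
p|U + p/2 and the ε-anti-invariant part e of p|U are both symmetric (`oddPart_eq`). Hence D(oddPart)
is a combination of square minus triangle for s, the square for e, and diagonals
(`doubleSum_oddPart`).

Square minus triangle tends to 0 because the weight is at least 3. In the other terms the parity of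
the coefficients leaves only the combinations S_r(a) + (-1)^r S_r(-a) of depth one sums. These tend
to rational multiples of (2πi)^r, by the Fourier series of Bernoulli polynomials and, for r = 1, by
the logarithm (`tendsto_singleSum_parity`).

Regularization plays no role. The only divergent indices have (s, b) = (1, 0), and their
coefficients vanish because p(a, a) is zero on the line X = Y (`binCoeff_oddPart_divergent`). So T
does not occur, and the remaining values are limits of truncated sums. -/

namespace ColoredDoubleZeta

/-! ### The linear action on functions of a pair of residue classes -/

section Slash

variable (γ γ' : Matrix (Fin 2) (Fin 2) ℤ)

/-- `slash γ` as an algebra homomorphism. -/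
noncomputable def slashHom : MvPolynomial (Fin 2) ℚ →ₐ[ℚ] MvPolynomial (Fin 2) ℚ :=
  MvPolynomial.aeval
    (fun i => MvPolynomial.C (γ i 0 : ℚ) * MvPolynomial.X 0 +
      MvPolynomial.C (γ i 1 : ℚ) * MvPolynomial.X 1)

theorem slash_eq_slashHom (f : MvPolynomial (Fin 2) ℚ) : slash γ f = slashHom γ f := rfl

theorem slashHom_X (i : Fin 2) : slashHom γ (MvPolynomial.X i) =
    MvPolynomial.C (γ i 0 : ℚ) * MvPolynomial.X 0 +
      MvPolynomial.C (γ i 1 : ℚ) * MvPolynomial.X 1 := by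
  simp [slashHom]

theorem slash_slash (f : MvPolynomial (Fin 2) ℚ) :
    slash γ (slash γ' f) = slash (γ' * γ) f := by
  simp only [slash_eq_slashHom]
  rw [← AlgHom.comp_apply]
  congr 1
  refine MvPolynomial.algHom_ext fun i => ?_
  simp only [AlgHom.comp_apply, slashHom_X, map_add, map_mul, MvPolynomial.algHom_C,
    Matrix.mul_apply, Fin.sum_univ_two, Int.cast_add, Int.cast_mul, MvPolynomial.algebraMap_eq]
  ring

theorem slash_one (f : MvPolynomial (Fin 2) ℚ) : slash 1 f = f := by
  have : slashHom 1 = AlgHom.id ℚ _ := by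
    refine MvPolynomial.algHom_ext fun i => ?_
    fin_cases i <;> simp [slashHom_X]
  rw [slash_eq_slashHom, this, AlgHom.id_apply]

theorem isHomogeneous_slash {f : MvPolynomial (Fin 2) ℚ} {w : ℕ} (hf : f.IsHomogeneous w) :
    (slash γ f).IsHomogeneous w := by
  have := hf.aeval (fun i => MvPolynomial.C (γ i 0 : ℚ) * MvPolynomial.X 0 +
      MvPolynomial.C (γ i 1 : ℚ) * MvPolynomial.X 1) (n := 1) fun i =>
    (((MvPolynomial.isHomogeneous_X ℚ (0 : Fin 2)).C_mul _).add
      ((MvPolynomial.isHomogeneous_X ℚ (1 : Fin 2)).C_mul _))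
  simpa [slash] using this

theorem slash_neg {f : MvPolynomial (Fin 2) ℚ} {w : ℕ} (hf : f.IsHomogeneous w) :
    slash (-γ) f = (-1) ^ w * slash γ f := by
  have h : ∀ e : Fin 2 →₀ ℕ, slashHom (-γ) (MvPolynomial.monomial e 1) =
      (-1) ^ (e 0 + e 1) * slashHom γ (MvPolynomial.monomial e 1) := by
    intro e
    have h1 : ∀ i, slashHom (-γ) (MvPolynomial.X i) = -1 * slashHom γ (MvPolynomial.X i) := by
      intro i
      simp only [slashHom_X, Matrix.neg_apply, Int.cast_neg, map_neg]
      ring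
    rw [MvPolynomial.monomial_eq, Finsupp.prod_fintype _ _ (by simp)]
    simp only [map_mul, Fin.prod_univ_two, map_pow, h1, mul_pow, pow_add, map_one]
    ring
  simp only [slash_eq_slashHom]
  rw [f.as_sum]
  simp only [map_sum, Finset.mul_sum]
  refine Finset.sum_congr rfl fun e he => ?_
  have hw : e 0 + e 1 = w := by
    have := hf (MvPolynomial.mem_support_iff.1 he)
    rw [Finsupp.weight_apply, Finsupp.sum_fintype _ _ (by simp)] at this
    simpa using this
  have hm : MvPolynomial.monomial e (f.coeff e) =
      f.coeff e • MvPolynomial.monomial e (1 : ℚ) := by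
    rw [MvPolynomial.smul_monomial, smul_eq_mul, mul_one]
  rw [hm, map_smul, map_smul, h, hw, mul_smul_comm]

end Slash

section Act

variable {N : ℕ} (γ γ' : Matrix (Fin 2) (Fin 2) ℤ)
  (f g : ZMod N → ZMod N → MvPolynomial (Fin 2) ℚ)

/-- The right action of integer matrices on polynomial valued functions of `(a, b)`, acting on
`(a, b)` and on `(X, Y)` simultaneously. -/
noncomputable def act : ZMod N → ZMod N → MvPolynomial (Fin 2) ℚ :=
  fun a b => slash γ (f (γ 0 0 * a + γ 0 1 * b) (γ 1 0 * a + γ 1 1 * b))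

/-- Reduces the functional equations below to identities between explicit integer matrices. -/
theorem act_act : act γ (act γ' f) = act (γ' * γ) f := by
  funext a b
  simp only [act, slash_slash, Matrix.mul_apply, Fin.sum_univ_two]
  push_cast
  congr 2 <;> ring

theorem act_add : act γ (f + g) = act γ f + act γ g := by
  funext a b
  simp only [act, Pi.add_apply, slash_eq_slashHom, map_add]

theorem act_neg : act γ (-f) = -act γ f := by
  funext a b
  simp only [act, Pi.neg_apply, slash_eq_slashHom, map_neg]

theorem act_sub : act γ (f - g) = act γ f - act γ g := by
  funext a b
  simp only [act, Pi.sub_apply, slash_eq_slashHom, map_sub]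

theorem act_smul (c : ℚ) : act γ (c • f) = c • act γ f := by
  funext a b
  simp only [act, Pi.smul_apply, slash_eq_slashHom, map_smul]

theorem act_zero : act γ (0 : ZMod N → ZMod N → MvPolynomial (Fin 2) ℚ) = 0 := by
  funext a b
  simp only [act, Pi.zero_apply, slash_eq_slashHom, map_zero]

end Act

/-! ### Bottom rows of matrices in `SL(2, ℤ)` modulo `N` -/

section Cosets

variable {N : ℕ}

theorem mem_A_iff [NeZero N] (p : ZMod N × ZMod N) : p ∈ A N ↔ IsCoprime p.1 p.2 := by
  obtain ⟨a, b⟩ := p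
  simp only [A, Finset.mem_filter, Finset.mem_univ, true_and]
  constructor
  · intro h
    have h1 : IsCoprime ((Nat.gcd a.val b.val : ℕ) : ℤ) N := Nat.isCoprime_iff_coprime.2 h
    obtain ⟨x, y, hxy⟩ := h1
    rw [Nat.gcd_eq_gcd_ab] at hxy
    have := congrArg (Int.cast : ℤ → ZMod N) hxy
    push_cast at this
    simp only [ZMod.natCast_val, ZMod.cast_id', id, ZMod.natCast_self, mul_zero, add_zero] at this
    refine ⟨x * (Nat.gcdA a.val b.val : ℤ), x * (Nat.gcdB a.val b.val : ℤ), ?_⟩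
    rw [← this]
    ring
  · rintro ⟨x, y, hxy⟩
    have h1 : ((Nat.gcd (Nat.gcd a.val b.val) N : ℕ) : ℤ) ∣ 1 := by
      have hz : (((x.val * a.val + y.val * b.val : ℕ) : ℤ) : ZMod N) = ((1 : ℤ) : ZMod N) := by
        push_cast
        simpa using hxy
      rw [ZMod.intCast_eq_intCast_iff_dvd_sub] at hz
      have ha : Nat.gcd (Nat.gcd a.val b.val) N ∣ a.val :=
        (Nat.gcd_dvd_left _ _).trans (Nat.gcd_dvd_left _ _)
      have hb : Nat.gcd (Nat.gcd a.val b.val) N ∣ b.val :=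
        (Nat.gcd_dvd_left _ _).trans (Nat.gcd_dvd_right _ _)
      have hab : ((Nat.gcd (Nat.gcd a.val b.val) N : ℕ) : ℤ) ∣
          ((x.val * a.val + y.val * b.val : ℕ) : ℤ) :=
        Int.natCast_dvd_natCast.2 (dvd_add (ha.mul_left _) (hb.mul_left _))
      have hN := (Int.natCast_dvd_natCast.2 (Nat.gcd_dvd_right (Nat.gcd a.val b.val) N)).trans hz
      simpa using dvd_add hN hab
    have h2 := Int.natCast_dvd_natCast.1 (by simpa using h1 : _ ∣ ((1 : ℕ) : ℤ))
    exact Nat.dvd_one.1 h2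

/-- A coprime pair modulo `N` lifts to the bottom row of a matrix in `SL(2, ℤ)`. -/
theorem exists_bottomRow [NeZero N] {c d : ZMod N} (h : IsCoprime c d) :
    ∃ g : SL(2, ℤ), ((g 1 0 : ℤ) : ZMod N) = c ∧ ((g 1 1 : ℤ) : ZMod N) = d := by
  have hN : N ≠ 0 := NeZero.ne N
  -- Adding N makes the representative of c nonzero, even for c = 0.
  set C : ℕ := c.val + N with hC
  have hC0 : NeZero C := ⟨by omega⟩
  have hCc : (C : ZMod N) = c := by simp [hC]
  set n := Nat.gcd C N with hn
  have hnC : n ∣ C := Nat.gcd_dvd_left _ _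
  have hnN : n ∣ N := Nat.gcd_dvd_right _ _
  have hu : IsUnit (d.val : ZMod n) := by
    obtain ⟨x, y, hxy⟩ := h
    have := congrArg (ZMod.castHom hnN (ZMod n)) hxy
    simp only [map_add, map_mul, map_one] at this
    have hc0 : (ZMod.castHom hnN (ZMod n)) c = 0 := by
      rw [← hCc, map_natCast]
      exact (ZMod.natCast_eq_zero_iff _ _).2 hnC
    have hd : (ZMod.castHom hnN (ZMod n)) d = (d.val : ZMod n) := by
      conv_lhs => rw [← ZMod.natCast_zmod_val d, map_natCast]
    rw [hc0, hd, mul_zero, zero_add] at this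
    exact IsUnit.of_mul_eq_one_right _ this
  -- Modulo n = gcd(C, N) the class of d is a unit, and units lift from ℤ/n to ℤ/C.
  obtain ⟨v, hv⟩ := ZMod.unitsMap_surjective hnC hu.unit
  have hv' : ((v : ZMod C).val : ZMod n) = (d.val : ZMod n) := by
    have := congrArg Units.val hv
    rw [ZMod.unitsMap_val, IsUnit.unit_spec] at this
    rw [← this, ZMod.natCast_val]
  have hcop : IsCoprime ((v : ZMod C).val : ℤ) (C : ℤ) :=
    Nat.isCoprime_iff_coprime.2 (ZMod.val_coe_unit_coprime v)
  have hdvd : (n : ℤ) ∣ (d.val : ℤ) - ((v : ZMod C).val : ℤ) := by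
    rw [← ZMod.intCast_eq_intCast_iff_dvd_sub]
    exact_mod_cast hv'
  obtain ⟨t, ht⟩ := hdvd
  have hbez : (n : ℤ) = C * Nat.gcdA C N + N * Nat.gcdB C N := Nat.gcd_eq_gcd_ab C N
  -- As d - v = t n, Bézout for n splits it into a multiple of C and a multiple of N. Adding only
  -- the former to v keeps coprimality to C and gives d modulo N.
  set D : ℤ := (v : ZMod C).val + (t * Nat.gcdA C N) * C with hD
  have hcop' : IsCoprime D (C : ℤ) := by
    rw [hD]
    exact IsCoprime.add_mul_right_left hcop _
  have hDd : (D : ZMod N) = d := by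
    have h1 : D = d.val - N * (Nat.gcdB C N * t) := by
      rw [hD]
      linear_combination -ht - t * hbez
    rw [h1]
    push_cast
    simp
  obtain ⟨x, y, hxy⟩ := hcop'
  refine ⟨⟨!![x, -y; C, D], ?_⟩, ?_, ?_⟩
  · rw [Matrix.det_fin_two_of]
    linear_combination hxy
  · simpa using hCc
  · simpa using hDd

/-- A left `Γ₁(N)`-invariant function depends only on the bottom row modulo `N`. -/
theorem eq_of_bottomRow_eq {P : SL(2, ℤ) → MvPolynomial (Fin 2) ℚ}
    (hP : ∀ γ ∈ CongruenceSubgroup.Gamma1 N, ∀ g, P (γ * g) = P g) {g h : SL(2, ℤ)}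
    (h0 : ((g 1 0 : ℤ) : ZMod N) = (h 1 0 : ℤ)) (h1 : ((g 1 1 : ℤ) : ZMod N) = (h 1 1 : ℤ)) :
    P g = P h := by
  have hmem : g * h⁻¹ ∈ CongruenceSubgroup.Gamma1 N := by
    have hg := congrArg (Int.cast : ℤ → ZMod N) (Matrix.SpecialLinearGroup.det_coe g)
    have hh := congrArg (Int.cast : ℤ → ZMod N) (Matrix.SpecialLinearGroup.det_coe h)
    rw [Matrix.det_fin_two] at hg hh
    push_cast at hg hh
    rw [CongruenceSubgroup.Gamma1_mem]
    simp only [Matrix.SpecialLinearGroup.coe_mul, Matrix.SpecialLinearGroup.coe_inv,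
      Matrix.adjugate_fin_two, Matrix.mul_apply, Fin.sum_univ_two, Matrix.of_apply,
      Matrix.cons_val', Matrix.cons_val_zero, Matrix.cons_val_one, Matrix.cons_val_fin_one]
    push_cast
    rw [h0, h1] at *
    refine ⟨?_, ?_, ?_⟩
    · linear_combination hg
    · linear_combination hh
    · ring
  have := hP _ hmem h
  simpa using this

end Cosets

/-! ### Period polynomials as functions of a pair of residue classes -/

section PeriodFunction

variable {N : ℕ}

open Classical in
/-- The value of `P` at the matrices with bottom row congruent to `(-d, c)`. -/
noncomputable def rowFun (N : ℕ) (P : SL(2, ℤ) → MvPolynomial (Fin 2) ℚ) :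
    ZMod N → ZMod N → MvPolynomial (Fin 2) ℚ :=
  fun c d => if h : ∃ g : SL(2, ℤ), ((g 1 0 : ℤ) : ZMod N) = -d ∧ ((g 1 1 : ℤ) : ZMod N) = c
    then P h.choose else 0

variable {P : SL(2, ℤ) → MvPolynomial (Fin 2) ℚ}

theorem rowFun_eq (hP : ∀ γ ∈ CongruenceSubgroup.Gamma1 N, ∀ g, P (γ * g) = P g) (g : SL(2, ℤ))
    {c d : ZMod N} (hc : ((g 1 1 : ℤ) : ZMod N) = c) (hd : ((g 1 0 : ℤ) : ZMod N) = -d) :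
    rowFun N P c d = P g := by
  have h : ∃ g : SL(2, ℤ), ((g 1 0 : ℤ) : ZMod N) = -d ∧ ((g 1 1 : ℤ) : ZMod N) = c :=
    ⟨g, hd, hc⟩
  rw [rowFun, dif_pos h]
  exact eq_of_bottomRow_eq hP (h.choose_spec.1.trans hd.symm) (h.choose_spec.2.trans hc.symm)

theorem rowFun_eq_zero [NeZero N] {c d : ZMod N} (h : ¬ IsCoprime c d) : rowFun N P c d = 0 := by
  rw [rowFun, dif_neg]
  rintro ⟨g, h0, h1⟩
  refine h ?_
  have hg := congrArg (Int.cast : ℤ → ZMod N) (Matrix.SpecialLinearGroup.det_coe g)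
  rw [Matrix.det_fin_two] at hg
  push_cast at hg
  exact ⟨(g 0 0 : ℤ), (g 0 1 : ℤ), by rw [← h1]; linear_combination hg + (g 0 1 : ℤ) * h0⟩

theorem isHomogeneous_rowFun {w : ℕ} (hP : ∀ g, (P g).IsHomogeneous w) (c d : ZMod N) :
    (rowFun N P c d).IsHomogeneous w := by
  rw [rowFun]
  split_ifs
  · exact hP _
  · exact MvPolynomial.isHomogeneous_zero _ _ _

/-- Bézout coefficients transform by the matrix in one direction and by its adjugate in the other; a
determinant ±1 is its own inverse. -/
theorem isCoprime_linear_iff {R : Type*} [CommRing R] (x y z t : ℤ) (h : x * t - y * z = 1 ∨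
    x * t - y * z = -1) (c d : R) : IsCoprime (x * c + y * d) (z * c + t * d) ↔ IsCoprime c d := by
  have hs : ((x : R) * t - y * z) * (x * t - y * z) = 1 := by
    rcases h with h | h <;>
    · have := congrArg (Int.cast : ℤ → R) h
      push_cast at this
      rw [this]
      ring
  constructor
  · rintro ⟨p, q, hpq⟩
    exact ⟨p * x + q * z, p * y + q * t, by rw [← hpq]; ring⟩
  · rintro ⟨p, q, hpq⟩
    refine ⟨((x : R) * t - y * z) * (p * t - q * z), ((x : R) * t - y * z) * (q * x - p * y), ?_⟩
    rw [← hs]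
    linear_combination ((x : R) * t - y * z) * (x * t - y * z) * hpq

/-- On `rowFun`, the action of `SL(2, ℤ)` on cosets becomes the linear action `act`. -/
theorem act_rowFun [NeZero N] (hP : ∀ γ ∈ CongruenceSubgroup.Gamma1 N, ∀ g, P (γ * g) = P g)
    (γ g : SL(2, ℤ)) {c d : ZMod N}
    (hc : ((g 1 1 : ℤ) : ZMod N) = c) (hd : ((g 1 0 : ℤ) : ZMod N) = -d) :
    act (γ : Matrix (Fin 2) (Fin 2) ℤ) (rowFun N P) c d = slashSL P γ g := by
  rw [act, slashSL]
  congr 1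
  -- The row (-d, c) times γ⁻¹ is (-d', c'), where (c', d') is γ applied to the column (c, d).
  apply rowFun_eq hP
  · simp only [Matrix.SpecialLinearGroup.coe_mul, Matrix.SpecialLinearGroup.coe_inv,
      Matrix.adjugate_fin_two, Matrix.mul_apply, Fin.sum_univ_two, Matrix.of_apply,
      Matrix.cons_val', Matrix.cons_val_zero, Matrix.cons_val_one, Matrix.cons_val_fin_one]
    push_cast
    rw [hc, hd]
    ring
  · simp only [Matrix.SpecialLinearGroup.coe_mul, Matrix.SpecialLinearGroup.coe_inv,
      Matrix.adjugate_fin_two, Matrix.mul_apply, Fin.sum_univ_two, Matrix.of_apply,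
      Matrix.cons_val', Matrix.cons_val_zero, Matrix.cons_val_one, Matrix.cons_val_fin_one]
    push_cast
    rw [hc, hd]
    ring

theorem act_eq_zero [NeZero N] {f : ZMod N → ZMod N → MvPolynomial (Fin 2) ℚ}
    (hf : ∀ c d, ¬ IsCoprime c d → f c d = 0) (γ : Matrix (Fin 2) (Fin 2) ℤ)
    (h : γ 0 0 * γ 1 1 - γ 0 1 * γ 1 0 = 1 ∨ γ 0 0 * γ 1 1 - γ 0 1 * γ 1 0 = -1)
    {c d : ZMod N} (hcd : ¬ IsCoprime c d) : act γ f c d = 0 := by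
  rw [act, hf _ _ (by rwa [isCoprime_linear_iff _ _ _ _ h]), slash_eq_slashHom, map_zero]

theorem exists_row [NeZero N] {c d : ZMod N} (h : IsCoprime c d) :
    ∃ g : SL(2, ℤ), ((g 1 1 : ℤ) : ZMod N) = c ∧ ((g 1 0 : ℤ) : ZMod N) = -d := by
  obtain ⟨g, h0, h1⟩ := exists_bottomRow h.symm.neg_left
  exact ⟨g, h1, h0⟩

end PeriodFunction

section MatrixNames

/-- The matrix `(0 -1; 1 0)`. -/
abbrev mS : Matrix (Fin 2) (Fin 2) ℤ := !![0, -1; 1, 0]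
/-- The matrix `(1 -1; 1 0)`. -/
abbrev mU : Matrix (Fin 2) (Fin 2) ℤ := !![1, -1; 1, 0]
/-- The matrix exchanging the coordinates. -/
abbrev mSwap : Matrix (Fin 2) (Fin 2) ℤ := !![0, 1; 1, 0]
/-- The matrix `(1 1; 0 1)`. -/
abbrev mT : Matrix (Fin 2) (Fin 2) ℤ := !![1, 1; 0, 1]
/-- The matrix `(1 0; 0 -1)`. -/
abbrev mNegY : Matrix (Fin 2) (Fin 2) ℤ := !![1, 0; 0, -1]

end MatrixNames

/-- The relations of an even period polynomial, for functions of a pair of residue classes. -/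
structure IsEvenPeriod {N : ℕ} (w : ℕ) (p : ZMod N → ZMod N → MvPolynomial (Fin 2) ℚ) : Prop where
  homogeneous : ∀ a b, (p a b).IsHomogeneous w
  eq_zero : ∀ a b, ¬ IsCoprime a b → p a b = 0
  act_neg_one : act (-1) p = p
  act_eps : act eps p = p
  act_swap : act mSwap p = -p
  act_U : p + act mU p + act (mU * mU) p = 0

section Period

variable {N w : ℕ} {P : SL(2, ℤ) → MvPolynomial (Fin 2) ℚ}

theorem mem_WBar_one (hP : P ∈ WBar (CongruenceSubgroup.Gamma1 N) w 1) :
    P ∈ W (CongruenceSubgroup.Gamma1 N) w ∧ ∀ g, slashEps P g = (-1) ^ w * P g := by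
  rw [WBar] at hP
  split_ifs at hP with h
  · refine ⟨hP.1, fun g => ?_⟩
    rw [hP.2, h.neg_one_pow]
    simp
  · refine ⟨hP.1, fun g => ?_⟩
    rw [hP.2, (Nat.not_even_iff_odd.1 h).neg_one_pow]
    simp

theorem epsConj_one_one (g : SL(2, ℤ)) : epsConj g 1 1 = g 1 1 := by
  change (eps * (g : Matrix (Fin 2) (Fin 2) ℤ) * eps) 1 1 = g 1 1
  rw [Matrix.mul_apply, Fin.sum_univ_two, Matrix.mul_apply, Matrix.mul_apply]
  simp [eps]

theorem epsConj_one_zero (g : SL(2, ℤ)) : epsConj g 1 0 = -g 1 0 := by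
  change (eps * (g : Matrix (Fin 2) (Fin 2) ℤ) * eps) 1 0 = -g 1 0
  rw [Matrix.mul_apply, Fin.sum_univ_two, Matrix.mul_apply, Matrix.mul_apply]
  simp [eps]

/-- On coprime pairs the relations come from those of P; elsewhere both sides vanish. Conjugation by
ε sends (c, d) to (c, -d), so it is paired with the matrix -ε. The sign (-1)^w from -1 then cancels
the eigenvalue (-1)^w, and invariance without sign remains. The relations for ε and the exchange
follow by composing with -1 and S. -/
theorem isEvenPeriod_rowFun [NeZero N] (hP : P ∈ WBar (CongruenceSubgroup.Gamma1 N) w 1) :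
    IsEvenPeriod w (rowFun N P) := by
  obtain ⟨⟨⟨hhom, hinv, hJ⟩, hS, hU⟩, hε⟩ := mem_WBar_one hP
  set p := rowFun N P with hp
  have hp0 : ∀ a b, ¬ IsCoprime a b → p a b = 0 := fun a b => rowFun_eq_zero
  have hph : ∀ a b, (p a b).IsHomogeneous w := isHomogeneous_rowFun hhom
  have h1 : act (-1) p = p := by
    funext a b
    by_cases hab : IsCoprime a b
    · obtain ⟨g, hc, hd⟩ := exists_row hab
      have := act_rowFun hinv (-1) g hc hd
      rw [Matrix.SpecialLinearGroup.coe_neg, Matrix.SpecialLinearGroup.coe_one] at this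
      rw [this, hJ, hp, rowFun_eq hinv g hc hd]
    · rw [hp0 a b hab, act_eq_zero hp0 _ (by simp) hab]
  have h2 : act mS p = -p := by
    funext a b
    by_cases hab : IsCoprime a b
    · obtain ⟨g, hc, hd⟩ := exists_row hab
      have := act_rowFun hinv ModularGroup.S g hc hd
      rw [ModularGroup.coe_S] at this
      rw [this, Pi.neg_apply, Pi.neg_apply, hp, rowFun_eq hinv g hc hd]
      exact (neg_eq_of_add_eq_zero_right (congrFun hS g)).symm
    · rw [Pi.neg_apply, Pi.neg_apply, hp0 a b hab, act_eq_zero hp0 _ (by simp) hab, neg_zero]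
  have h3 : p + act mU p + act (mU * mU) p = 0 := by
    funext a b
    simp only [Pi.add_apply, Pi.zero_apply]
    by_cases hab : IsCoprime a b
    · obtain ⟨g, hc, hd⟩ := exists_row hab
      have e1 := act_rowFun hinv U g hc hd
      have e2 := act_rowFun hinv (U ^ 2) g hc hd
      rw [pow_two, Matrix.SpecialLinearGroup.coe_mul] at e2
      rw [show (U : Matrix (Fin 2) (Fin 2) ℤ) = mU from rfl] at e1 e2
      rw [e1, e2, hp, rowFun_eq hinv g hc hd, ← pow_two]
      exact congrFun hU g
    · rw [hp0 a b hab, act_eq_zero hp0 _ (by simp) hab, act_eq_zero hp0 _ (by decide) hab]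
      simp
  have h4 : act mNegY p = p := by
    funext a b
    by_cases hab : IsCoprime a b
    · obtain ⟨g, hc, hd⟩ := exists_row hab
      have e1 : p a (-b) = P (epsConj g) := by
        apply rowFun_eq hinv
        · rw [epsConj_one_one, hc]
        · rw [epsConj_one_zero, Int.cast_neg, hd]
      have e2 := hε g
      rw [slashEps, ← e1] at e2
      have e3 : act mNegY p a b = slash (-eps) (p a (-b)) := by
        have : mNegY = -eps := by ext i j; fin_cases i <;> fin_cases j <;> rfl
        rw [act, this]
        simp [eps]
      rw [e3, slash_neg _ (hph _ _), e2, ← mul_assoc, ← mul_pow, hp, rowFun_eq hinv g hc hd]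
      simp
    · rw [hp0 a b hab, act_eq_zero hp0 _ (by simp) hab]
  refine ⟨hph, hp0, h1, ?_, ?_, h3⟩
  · have : act eps p = act (mNegY) (act (-1) p) := by
      rw [act_act]
      congr 1
      decide
    rw [this, h1, h4]
  · have : act mSwap p = act (mNegY) (act mS p) := by
      rw [act_act]
      congr 1
      decide
    rw [this, h2, act_neg, h4]

end Period

/-! ### The decomposition of the odd part -/

section Decomposition

variable {N w : ℕ} {p : ZMod N → ZMod N → MvPolynomial (Fin 2) ℚ}

/-- The odd part of `p|U`. -/
noncomputable def oddPart (p : ZMod N → ZMod N → MvPolynomial (Fin 2) ℚ) :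
    ZMod N → ZMod N → MvPolynomial (Fin 2) ℚ :=
  (1 / 2 : ℚ) • (act mU p + act eps (act mU p))

/-- The function `p|U + p/2`. -/
noncomputable def shiftPart (p : ZMod N → ZMod N → MvPolynomial (Fin 2) ℚ) :
    ZMod N → ZMod N → MvPolynomial (Fin 2) ℚ :=
  act mU p + (1 / 2 : ℚ) • p

/-- The even part of `p|U`. -/
noncomputable def evenPart (p : ZMod N → ZMod N → MvPolynomial (Fin 2) ℚ) :
    ZMod N → ZMod N → MvPolynomial (Fin 2) ℚ :=
  (1 / 2 : ℚ) • (act mU p - act eps (act mU p))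

namespace IsEvenPeriod

variable (hp : IsEvenPeriod w p)
include hp

/-- Apply ε to the three-term relation; U²ε is minus the exchange times T, and p is antisymmetric.
-/
theorem act_U_eps_eq : act mT p = p + act eps (act mU p) := by
  have h := congrArg (act eps) hp.act_U
  rw [act_add, act_add, hp.act_eps, act_zero] at h
  have : act eps (act (mU * mU) p) = act mT (act mSwap (act (-1) p)) := by
    rw [act_act, act_act, act_act]
    congr 1
    decide
  rw [this, hp.act_neg_one, hp.act_swap, act_neg, ← sub_eq_add_neg, sub_eq_zero] at h
  exact h.symm

theorem act_swap_act_U : act mSwap (act mU p) = p + act mU p := by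
  have : act mSwap (act mU p) = act (mU * mU) (act mSwap (act (-1) p)) := by
    rw [act_act, act_act, act_act]
    congr 1
    decide
  rw [this, hp.act_neg_one, hp.act_swap, act_neg]
  exact (eq_neg_of_add_eq_zero_left hp.act_U).symm

theorem act_swap_act_eps_act_U :
    act mSwap (act eps (act mU p)) = p + act eps (act mU p) := by
  have : act mSwap (act eps (act mU p)) = act mT (act (-1) p) := by
    rw [act_act, act_act, act_act]
    congr 1
    decide
  rw [this, hp.act_neg_one, hp.act_U_eps_eq]

/-- UT is minus the exchange times Uε. -/
theorem act_T_act_U : act mT (act mU p) = -act eps (act mU p) := by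
  have : act mT (act mU p) = act eps (act mU (act mSwap (act (-1) p))) := by
    rw [act_act, act_act, act_act, act_act]
    congr 1
    decide
  rw [this, hp.act_neg_one, hp.act_swap, act_neg, act_neg]

/-- The exchange sends p|U to p + p|U and p to -p, so adding p/2 is the correction that makes p|U
symmetric. -/
theorem act_swap_shiftPart : act mSwap (shiftPart p) = shiftPart p := by
  rw [shiftPart, act_add, act_smul, hp.act_swap, hp.act_swap_act_U]
  module

theorem act_swap_evenPart : act mSwap (evenPart p) = evenPart p := by
  rw [evenPart, act_smul, act_sub, hp.act_swap_act_U, hp.act_swap_act_eps_act_U]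
  module

/-- With A = p|U and B = p|Uε one has s|T = (p - B)/2 for s = A + p/2, hence s - s|T = A + B/2.
Subtracting a multiple of (A - B)/2 balances the two coefficients to (A + B)/2. -/
theorem oddPart_eq : oddPart p = (2 / 3 : ℚ) • (shiftPart p - act mT (shiftPart p)) -
    (1 / 3 : ℚ) • evenPart p := by
  rw [shiftPart, act_add, act_smul, hp.act_T_act_U, hp.act_U_eps_eq, oddPart, evenPart]
  module

theorem act_neg_one_act (γ : Matrix (Fin 2) (Fin 2) ℤ) : act (-1) (act γ p) = act γ p := by
  conv_rhs => rw [← hp.act_neg_one]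
  rw [act_act, act_act]
  congr 1
  rw [mul_neg, neg_mul, mul_one, one_mul]

theorem act_neg_one_shiftPart : act (-1) (shiftPart p) = shiftPart p := by
  rw [shiftPart, act_add, act_smul, hp.act_neg_one, hp.act_neg_one_act]

theorem act_neg_one_evenPart : act (-1) (evenPart p) = evenPart p := by
  rw [evenPart, act_smul, act_sub, act_act eps, hp.act_neg_one_act, hp.act_neg_one_act]

omit hp in
theorem act_eps_evenPart : act eps (evenPart p) = -evenPart p := by
  have : act eps (act eps (act mU p)) = act mU p := by
    rw [act_act, act_act]
    congr 1
    decide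
  rw [evenPart, act_smul, act_sub, this]
  module

end IsEvenPeriod

end Decomposition

/-! ### Binary monomials -/

section Monomials

open MvPolynomial

/-- The exponent of the monomial `X^i Y^j`. -/
noncomputable def binExp (i j : ℕ) : Fin 2 →₀ ℕ := Finsupp.single 0 i + Finsupp.single 1 j

theorem binExp_apply_zero (i j : ℕ) : binExp i j 0 = i := by simp [binExp]

theorem binExp_apply_one (i j : ℕ) : binExp i j 1 = j := by simp [binExp]

theorem binExp_self (e : Fin 2 →₀ ℕ) : binExp (e 0) (e 1) = e := by
  ext i
  fin_cases i <;> simp [binExp]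

theorem binExp_inj {i j k l : ℕ} : binExp i j = binExp k l ↔ i = k ∧ j = l := by
  constructor
  · intro h
    exact ⟨by rw [← binExp_apply_zero i j, h, binExp_apply_zero],
      by rw [← binExp_apply_one i j, h, binExp_apply_one]⟩
  · rintro ⟨rfl, rfl⟩
    rfl

theorem X_pow_mul_X_pow (i j : ℕ) :
    (X 0 ^ i * X 1 ^ j : MvPolynomial (Fin 2) ℚ) = monomial (binExp i j) 1 := by
  rw [monomial_eq, Finsupp.prod_fintype _ _ (by simp), Fin.prod_univ_two, binExp_apply_zero,
    binExp_apply_one, map_one, one_mul]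

theorem binary_linearMap_ext {M : Type*} [AddCommGroup M] [Module ℚ M]
    {F G : MvPolynomial (Fin 2) ℚ →ₗ[ℚ] M}
    (h : ∀ i j : ℕ, F (X 0 ^ i * X 1 ^ j) = G (X 0 ^ i * X 1 ^ j)) : F = G := by
  refine (basisMonomials (Fin 2) ℚ).ext fun e => ?_
  have := h (e 0) (e 1)
  rwa [X_pow_mul_X_pow, binExp_self] at this

/-- The coefficient of `X^i Y^j`. -/
noncomputable def binCoeff (i j : ℕ) : MvPolynomial (Fin 2) ℚ →ₗ[ℚ] ℚ :=
  MvPolynomial.lcoeff ℚ (binExp i j)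

theorem binCoeff_apply (i j : ℕ) (f : MvPolynomial (Fin 2) ℚ) :
    binCoeff i j f = f.coeff (binExp i j) := rfl

theorem binCoeff_X_pow (i j k l : ℕ) :
    binCoeff i j (X 0 ^ k * X 1 ^ l) = if k = i ∧ l = j then 1 else 0 := by
  rw [X_pow_mul_X_pow, binCoeff_apply, coeff_monomial]
  simp only [binExp_inj]

theorem eq_sum_binCoeff {f : MvPolynomial (Fin 2) ℚ} {w : ℕ} (hf : f.IsHomogeneous w) :
    f = ∑ e ∈ Finset.HasAntidiagonal.antidiagonal w,
      binCoeff e.1 e.2 f • (X 0 ^ e.1 * X 1 ^ e.2) := by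
  ext d
  simp only [coeff_sum, coeff_smul, X_pow_mul_X_pow, coeff_monomial, smul_eq_mul, mul_ite,
    mul_one, mul_zero]
  rw [← binExp_self d]
  simp only [binExp_inj]
  by_cases hd : d 0 + d 1 = w
  · rw [Finset.sum_eq_single (d 0, d 1)]
    · simp [binCoeff_apply]
    · rintro ⟨i, j⟩ _ hne
      rw [if_neg]
      rintro ⟨h1, h2⟩
      exact hne (Prod.ext h1 h2)
    · intro h
      exact absurd (Finset.HasAntidiagonal.mem_antidiagonal.2 hd) h
  · rw [Finset.sum_eq_zero]
    · refine hf.coeff_eq_zero ?_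
      rw [Finsupp.degree_eq_sum, Fin.sum_univ_two, binExp_apply_zero, binExp_apply_one]
      exact hd
    · rintro ⟨i, j⟩ hij
      rw [if_neg]
      rintro ⟨rfl, rfl⟩
      exact hd (Finset.HasAntidiagonal.mem_antidiagonal.1 hij)

theorem binCoeff_slash_eps (i j : ℕ) (f : MvPolynomial (Fin 2) ℚ) :
    binCoeff i j (slash eps f) = (-1) ^ i * binCoeff i j f := by
  have : (binCoeff i j) ∘ₗ (slashHom eps).toLinearMap = ((-1 : ℚ) ^ i) • binCoeff i j := by
    refine binary_linearMap_ext fun k l => ?_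
    have h0 : slashHom eps (X 0) = C (-1) * X 0 := by simp [slashHom_X, eps]
    have h1 : slashHom eps (X 1) = X 1 := by simp [slashHom_X, eps]
    rw [LinearMap.comp_apply, AlgHom.toLinearMap_apply, map_mul, map_pow, map_pow, h0, h1,
      mul_pow, ← map_pow, mul_assoc, ← smul_eq_C_mul, map_smul, LinearMap.smul_apply,
      binCoeff_X_pow]
    split_ifs with h
    · rw [h.1]
    · simp
  exact LinearMap.congr_fun this f

end Monomials

/-! ### The pairing with `1 / (m^(i+1) n^(j+1))` -/

section Laplace

open MvPolynomial

/-- The linear map `X^i Y^j ↦ i! j! / (m^(i+1) n^(j+1))`, the Laplace transform at `(m, n)`. -/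
noncomputable def laplace (m n : ℂ) : MvPolynomial (Fin 2) ℚ →ₗ[ℚ] ℂ :=
  (basisMonomials (Fin 2) ℚ).constr ℚ
    fun e => ((e 0)! : ℂ) * ((e 1)! : ℂ) / (m ^ (e 0 + 1) * n ^ (e 1 + 1))

theorem laplace_X_pow (m n : ℂ) (i j : ℕ) : laplace m n (X 0 ^ i * X 1 ^ j) =
    (i ! : ℂ) * (j ! : ℂ) / (m ^ (i + 1) * n ^ (j + 1)) := by
  have h := (basisMonomials (Fin 2) ℚ).constr_basis ℚ
    (fun e => ((e 0)! : ℂ) * ((e 1)! : ℂ) / (m ^ (e 0 + 1) * n ^ (e 1 + 1))) (binExp i j)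
  rw [X_pow_mul_X_pow, laplace]
  rw [coe_basisMonomials] at h
  rw [h, binExp_apply_zero, binExp_apply_one]

theorem laplace_swap (m n : ℂ) (f : MvPolynomial (Fin 2) ℚ) :
    laplace m n (slash mSwap f) = laplace n m f := by
  have : laplace m n ∘ₗ (slashHom mSwap).toLinearMap = laplace n m := by
    refine binary_linearMap_ext fun k l => ?_
    have h0 : slashHom mSwap (X 0) = X 1 := by simp [slashHom_X]
    have h1 : slashHom mSwap (X 1) = X 0 := by simp [slashHom_X]
    rw [LinearMap.comp_apply, AlgHom.toLinearMap_apply, map_mul, map_pow, map_pow, h0, h1,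
      mul_comm, laplace_X_pow, laplace_X_pow]
    ring
  exact LinearMap.congr_fun this f

/-- Integration by parts in the second variable. -/
theorem mul_laplace (m : ℂ) {l : ℂ} (hl : l ≠ 0) (f : MvPolynomial (Fin 2) ℚ) :
    l * laplace m l f = laplace m l (pderiv 1 f) + laplace m 1 (aeval ![X 0, 0] f) := by
  -- The boundary term is a polynomial in X alone; on it the second parameter 1 contributes only the
  -- factor 1.
  have : l • laplace m l = laplace m l ∘ₗ (pderiv 1 : Derivation ℚ _ _).toLinearMap +
      laplace m 1 ∘ₗ (aeval ![X 0, 0] : MvPolynomial (Fin 2) ℚ →ₐ[ℚ] _).toLinearMap := by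
    refine binary_linearMap_ext fun i j => ?_
    have hd : pderiv 1 (X 0 ^ i * X 1 ^ j : MvPolynomial (Fin 2) ℚ) =
        (j : ℚ) • (X 0 ^ i * X 1 ^ (j - 1)) := by
      rw [Derivation.leibniz, Derivation.leibniz_pow, Derivation.leibniz_pow, pderiv_X_self,
        pderiv_X_of_ne (by decide), smul_eq_C_mul]
      simp only [smul_eq_mul, nsmul_eq_mul, map_natCast]
      ring
    simp only [LinearMap.smul_apply, LinearMap.add_apply, LinearMap.comp_apply,
      AlgHom.toLinearMap_apply, Derivation.coeFn_coe, hd, map_smul,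
      laplace_X_pow, map_mul, map_pow, aeval_X, Matrix.cons_val_zero, Matrix.cons_val_one,
      Matrix.cons_val_fin_one]
    rcases j with _ | j
    · have := laplace_X_pow m 1 i 0
      simp only [pow_zero, mul_one] at this
      rw [pow_zero, mul_one, this]
      simp only [Nat.factorial_zero, Nat.cast_one, one_pow, Nat.cast_zero, zero_smul, smul_eq_mul]
      field_simp
      ring
    · rw [zero_pow (by omega), mul_zero, map_zero, Nat.factorial_succ, Nat.add_sub_cancel,
        Rat.smul_def, smul_eq_mul]
      push_cast
      field_simp
      ring
  exact LinearMap.congr_fun this f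

theorem laplace_shear_succ {m l : ℂ} (hl : l ≠ 0) (i j : ℕ) :
    l * laplace m l ((X 0 + X 1) ^ i * X 1 ^ j) =
      i * laplace m l ((X 0 + X 1) ^ (i - 1) * X 1 ^ j) +
      j * laplace m l ((X 0 + X 1) ^ i * X 1 ^ (j - 1)) +
      if j = 0 then (i ! : ℂ) / m ^ (i + 1) else 0 := by
  have hd : pderiv 1 ((X 0 + X 1) ^ i * X 1 ^ j : MvPolynomial (Fin 2) ℚ) =
      (i : ℚ) • ((X 0 + X 1) ^ (i - 1) * X 1 ^ j) +
      (j : ℚ) • ((X 0 + X 1) ^ i * X 1 ^ (j - 1)) := by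
    rw [Derivation.leibniz, Derivation.leibniz_pow, Derivation.leibniz_pow, map_add, pderiv_X_self,
      pderiv_X_of_ne (by decide), smul_eq_C_mul, smul_eq_C_mul]
    simp only [smul_eq_mul, nsmul_eq_mul, map_natCast]
    ring
  rw [mul_laplace m hl, hd, map_add, map_smul, map_smul, Rat.smul_def, Rat.smul_def]
  push_cast
  congr 1
  simp only [map_mul, map_pow, map_add, aeval_X, Matrix.cons_val_zero, Matrix.cons_val_one,
    Matrix.cons_val_fin_one, add_zero]
  split_ifs with h
  · have := laplace_X_pow m 1 i 0
    simp only [pow_zero, mul_one] at this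
    rw [h, pow_zero, mul_one, this]
    simp
  · rw [zero_pow h, mul_zero, map_zero]

/-- For Laplace integrals this is the splitting of the quadrant along its diagonal. Algebraically,
multiplying by m + n lowers the degree on both sides by the same recursion, so induction on i + j
applies; the boundary terms occur for i = 0 or j = 0. -/
theorem laplace_partialFraction_monomial {m n : ℂ} (hm : m ≠ 0) (hn : n ≠ 0) (h : m + n ≠ 0)
    (s : ℕ) : ∀ i j : ℕ, i + j = s →
    laplace m (m + n) ((X 0 + X 1) ^ i * X 1 ^ j) +
      laplace n (m + n) ((X 0 + X 1) ^ j * X 1 ^ i) =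
    (i ! : ℂ) * (j ! : ℂ) / (m ^ (i + 1) * n ^ (j + 1)) := by
  induction s with
  | zero =>
    intro i j hij
    obtain ⟨rfl, rfl⟩ : i = 0 ∧ j = 0 := by omega
    apply mul_left_cancel₀ h
    rw [mul_add, laplace_shear_succ h, laplace_shear_succ h]
    simp
    field_simp
    ring
  | succ s ih =>
    intro i j hij
    apply mul_left_cancel₀ h
    rw [mul_add, laplace_shear_succ h, laplace_shear_succ h]
    rcases i with _ | i
    · rcases j with _ | j
      · omega
      · have h1 := ih 0 j (by omega)
        simp only [Nat.add_sub_cancel, Nat.cast_zero, zero_mul, if_true, Nat.factorial_zero,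
          Nat.cast_one, one_mul, zero_add, add_zero, if_neg (Nat.succ_ne_zero j),
          Nat.factorial_succ, Nat.cast_mul] at h1 ⊢
        rw [← add_assoc, ← mul_add, h1]
        push_cast
        field_simp
        ring
    · rcases j with _ | j
      · have h1 := ih i 0 (by omega)
        simp only [Nat.add_sub_cancel, Nat.cast_zero, zero_mul, if_true, Nat.factorial_zero,
          Nat.cast_one, mul_one, zero_add, add_zero, if_neg (Nat.succ_ne_zero i),
          Nat.factorial_succ, Nat.cast_mul] at h1 ⊢
        rw [add_right_comm, ← mul_add, h1]
        push_cast
        field_simp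
        ring
      · have h1 := ih i (j + 1) (by omega)
        have h2 := ih (i + 1) j (by omega)
        simp only [Nat.add_sub_cancel, if_neg (Nat.succ_ne_zero _), add_zero] at h1 h2 ⊢
        have h3 : (m + n) * (((i + 1)! : ℂ) * ((j + 1)! : ℂ) /
            (m ^ (i + 1 + 1) * n ^ (j + 1 + 1))) =
            ((i + 1 : ℕ) : ℂ) * ((i ! : ℂ) * ((j + 1)! : ℂ) / (m ^ (i + 1) * n ^ (j + 1 + 1))) +
            ((j + 1 : ℕ) : ℂ) * (((i + 1)! : ℂ) * (j ! : ℂ) /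
              (m ^ (i + 1 + 1) * n ^ (j + 1))) := by
          simp only [Nat.factorial_succ]
          push_cast
          field_simp
          ring
        rw [h3, ← h1, ← h2]
        ring

/-- The partial fraction decomposition behind the shuffle product. -/
theorem laplace_partialFraction {m n : ℂ} (hm : m ≠ 0) (hn : n ≠ 0) (h : m + n ≠ 0)
    (f : MvPolynomial (Fin 2) ℚ) :
    laplace m n f = laplace m (m + n) (slash mT f) +
      laplace n (m + n) (slash mT (slash mSwap f)) := by
  have : laplace m n = laplace m (m + n) ∘ₗ (slashHom mT).toLinearMap +
      laplace n (m + n) ∘ₗ ((slashHom mT).comp (slashHom mSwap)).toLinearMap := by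
    refine binary_linearMap_ext fun i j => ?_
    have h0 : slashHom mSwap (X 0) = X 1 := by simp [slashHom_X]
    have h1 : slashHom mSwap (X 1) = X 0 := by simp [slashHom_X]
    have h2 : slashHom mT (X 0) = X 0 + X 1 := by simp [slashHom_X]
    have h3 : slashHom mT (X 1) = X 1 := by simp [slashHom_X]
    simp only [LinearMap.add_apply, LinearMap.comp_apply, AlgHom.toLinearMap_apply,
      AlgHom.comp_apply, map_mul, map_pow, h0, h1, h2, h3]
    rw [laplace_X_pow, ← laplace_partialFraction_monomial hm hn h (i + j) i j rfl,
      mul_comm (X 1 ^ i)]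
  exact LinearMap.congr_fun this f

theorem laplace_eq_sum (m n : ℂ) {f : MvPolynomial (Fin 2) ℚ} {w : ℕ} (hf : f.IsHomogeneous w) :
    laplace m n f = ∑ e ∈ Finset.HasAntidiagonal.antidiagonal w, (binCoeff e.1 e.2 f : ℂ) *
      ((e.1 ! : ℂ) * (e.2 ! : ℂ) / (m ^ (e.1 + 1) * n ^ (e.2 + 1))) := by
  conv_lhs => rw [eq_sum_binCoeff hf]
  simp only [map_sum, map_smul, laplace_X_pow, Rat.smul_def]

end Laplace

/-! ### Truncated double shuffle relations -/

section Truncated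

variable {N : ℕ}

theorem zetaN_pow_card (N : ℕ) [NeZero N] :
    Complex.exp (2 * Real.pi * Complex.I / N) ^ N = 1 := by
  rw [← Complex.exp_nat_mul, mul_div_cancel₀ _ (Nat.cast_ne_zero.2 (NeZero.ne N)),
    Complex.exp_two_pi_mul_I]

theorem zetaN_add [NeZero N] (a b : ZMod N) : zetaN N (a + b) = zetaN N a * zetaN N b := by
  rw [zetaN, zetaN, zetaN, ← pow_add, ZMod.val_add]
  conv_rhs => rw [← Nat.mod_add_div (a.val + b.val) N, pow_add, pow_mul, zetaN_pow_card, one_pow,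
    mul_one]

theorem zetaN_zero : zetaN N 0 = 1 := by simp [zetaN]

theorem zetaN_ne_zero (a : ZMod N) : zetaN N a ≠ 0 := pow_ne_zero _ (Complex.exp_ne_zero _)

variable (f g : ZMod N → ZMod N → MvPolynomial (Fin 2) ℚ)

/-- The summand `z_a^m z_b^n L(m, n)`, where `L` is the Laplace transform of `f a b`. -/
noncomputable def term (a b : ZMod N) (m n : ℕ) : ℂ :=
  zetaN N a ^ m * zetaN N b ^ n * laplace m n (f a b)

variable [NeZero N]

/-- The pairing of `f` with the double sums truncated at `M`. -/
noncomputable def doubleSum (M : ℕ) : ℂ :=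
  ∑ a, ∑ b, ∑ n ∈ Finset.Ico 1 M, ∑ m ∈ Finset.Ico 1 n, term f a b m n

/-- The pairing of `f` with products of truncated sums. -/
noncomputable def squareSum (M : ℕ) : ℂ :=
  ∑ a, ∑ b, ∑ n ∈ Finset.Ico 1 M, ∑ m ∈ Finset.Ico 1 M, term f a b m n

/-- The pairing of `f` with products of sums, truncated at `m + n < M`. -/
noncomputable def triangleSum (M : ℕ) : ℂ :=
  ∑ a, ∑ b, ∑ n ∈ Finset.Ico 1 M, ∑ m ∈ Finset.Ico 1 (M - n), term f a b m n

/-- The contribution of the diagonal to `squareSum`. -/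
noncomputable def diagSum (M : ℕ) : ℂ :=
  ∑ a, ∑ b, ∑ n ∈ Finset.Ico 1 M, term f a b n n

theorem doubleSum_sub (M : ℕ) : doubleSum (f - g) M = doubleSum f M - doubleSum g M := by
  simp only [doubleSum, term, Pi.sub_apply, map_sub, mul_sub, Finset.sum_sub_distrib]

theorem doubleSum_smul (c : ℚ) (M : ℕ) : doubleSum (c • f) M = c * doubleSum f M := by
  simp only [doubleSum, term, Pi.smul_apply, map_smul, Rat.smul_def, Finset.mul_sum]
  refine Finset.sum_congr rfl fun a _ => Finset.sum_congr rfl fun b _ =>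
    Finset.sum_congr rfl fun n _ => Finset.sum_congr rfl fun m _ => ?_
  ring

variable {f}

omit [NeZero N] in
theorem slash_swap_of_act_swap (hf : act mSwap f = f) (a b : ZMod N) :
    slash mSwap (f a b) = f b a := by
  conv_rhs => rw [← hf]
  simp [act]

omit [NeZero N] in
theorem term_swap (hf : act mSwap f = f) (a b : ZMod N) (m n : ℕ) :
    term f a b m n = term f b a n m := by
  rw [term, term, ← slash_swap_of_act_swap hf a b, laplace_swap]
  ring

/-- The truncated stuffle product. -/
theorem squareSum_eq (hf : act mSwap f = f) (M : ℕ) :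
    squareSum f M = 2 * doubleSum f M + diagSum f M := by
  have h1 : ∀ a b, ∑ n ∈ Finset.Ico 1 M, ∑ m ∈ Finset.Ico 1 M, term f a b m n =
      ∑ n ∈ Finset.Ico 1 M, ∑ m ∈ Finset.Ico 1 n, term f a b m n +
      ∑ n ∈ Finset.Ico 1 M, ∑ m ∈ Finset.Ico 1 n, term f b a m n +
      ∑ n ∈ Finset.Ico 1 M, term f a b n n := by
    intro a b
    have h2 : ∑ n ∈ Finset.Ico 1 M, ∑ m ∈ Finset.Ico 1 n, term f b a m n =
        ∑ n ∈ Finset.Ico 1 M, ∑ m ∈ Finset.Ico (n + 1) M, term f a b m n := by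
      rw [Finset.sum_comm' (t' := Finset.Ico 1 M) (s' := fun n => Finset.Ico (n + 1) M)]
      · simp only [term_swap hf b a]
      · intro x y
        simp only [Finset.mem_Ico]
        omega
    rw [h2, ← Finset.sum_add_distrib, ← Finset.sum_add_distrib]
    refine Finset.sum_congr rfl fun n hn => ?_
    rw [Finset.mem_Ico] at hn
    rw [← Finset.sum_Ico_consecutive _ (show 1 ≤ n by omega) (show n ≤ M by omega),
      Finset.sum_eq_sum_Ico_succ_bot (show n < M by omega)]
    ring
  rw [squareSum, doubleSum, diagSum]
  simp only [h1, Finset.sum_add_distrib]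
  rw [Finset.sum_comm (f := fun a b => ∑ n ∈ Finset.Ico 1 M, ∑ m ∈ Finset.Ico 1 n,
    term f b a m n)]
  ring

omit [NeZero N] in
theorem sum_sum_swap_triangle (G : ℕ → ℕ → ℂ) (M : ℕ) :
    ∑ n ∈ Finset.Ico 1 M, ∑ m ∈ Finset.Ico 1 (M - n), G n m =
      ∑ n ∈ Finset.Ico 1 M, ∑ m ∈ Finset.Ico 1 (M - n), G m n := by
  rw [Finset.sum_comm' (t' := Finset.Ico 1 M) (s' := fun n => Finset.Ico 1 (M - n))]
  intro x y
  simp only [Finset.mem_Ico]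
  omega

/-- One of the two summands in the partial fraction decomposition of `term`. -/
noncomputable def shearTerm (f : ZMod N → ZMod N → MvPolynomial (Fin 2) ℚ) (a b : ZMod N)
    (m n : ℕ) : ℂ :=
  zetaN N a ^ m * zetaN N b ^ n * laplace m (m + n : ℕ) (slash mT (f a b))

omit [NeZero N] in
theorem term_eq_shearTerm_add (hf : act mSwap f = f) (a b : ZMod N) {m n : ℕ} (hm : 1 ≤ m)
    (hn : 1 ≤ n) : term f a b m n = shearTerm f a b m n + shearTerm f b a n m := by
  have hmn : (m : ℂ) + n ≠ 0 := by
    rw [← Nat.cast_add]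
    exact Nat.cast_ne_zero.2 (by omega)
  rw [term, laplace_partialFraction (Nat.cast_ne_zero.2 (by omega))
    (Nat.cast_ne_zero.2 (by omega)) hmn, slash_swap_of_act_swap hf, shearTerm, shearTerm,
    Nat.cast_add, Nat.cast_add, add_comm (n : ℂ) m]
  ring

/-- Substitute a + b for a and use m + n as the new outer variable: z_{a+b}^m z_b^n = z_a^m
z_b^{m+n}, and the triangle m + n < M becomes the range of the double sum. -/
theorem sum_shearTerm (f : ZMod N → ZMod N → MvPolynomial (Fin 2) ℚ) (M : ℕ) :
    ∑ a, ∑ b, ∑ n ∈ Finset.Ico 1 M, ∑ m ∈ Finset.Ico 1 (M - n), shearTerm f a b m n =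
      doubleSum (act mT f) M := by
  rw [doubleSum, Finset.sum_comm, Finset.sum_comm (f := fun a b => ∑ n ∈ Finset.Ico 1 M,
    ∑ m ∈ Finset.Ico 1 n, term (act mT f) a b m n)]
  refine Finset.sum_congr rfl fun b _ => ?_
  rw [← Equiv.sum_comp (Equiv.addRight b)]
  refine Finset.sum_congr rfl fun a _ => ?_
  simp only [Equiv.coe_addRight]
  rw [Finset.sum_sigma', Finset.sum_sigma']
  refine Finset.sum_bij' (fun x _ => ⟨x.1 + x.2, x.2⟩) (fun x _ => ⟨x.1 - x.2, x.2⟩) ?_ ?_ ?_ ?_ ?_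
  · rintro ⟨n, m⟩ h
    simp only [Finset.mem_sigma, Finset.mem_Ico] at h ⊢
    omega
  · rintro ⟨n, m⟩ h
    simp only [Finset.mem_sigma, Finset.mem_Ico] at h ⊢
    omega
  · rintro ⟨n, m⟩ h
    simp
  · rintro ⟨n, m⟩ h
    simp only [Finset.mem_sigma, Finset.mem_Ico] at h
    simp only [Sigma.mk.injEq, heq_eq_eq, and_true]
    omega
  · rintro ⟨n, m⟩ h
    have e : act mT f a b = slash mT (f (a + b) b) := by simp [act]
    rw [shearTerm, term, e, zetaN_add, mul_pow, pow_add, add_comm m n]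
    ring

/-- The truncated shuffle product. -/
theorem triangleSum_eq (hf : act mSwap f = f) (M : ℕ) :
    triangleSum f M = 2 * doubleSum (act mT f) M := by
  have h : ∀ a b, ∑ n ∈ Finset.Ico 1 M, ∑ m ∈ Finset.Ico 1 (M - n), term f a b m n =
      ∑ n ∈ Finset.Ico 1 M, ∑ m ∈ Finset.Ico 1 (M - n), shearTerm f a b m n +
      ∑ n ∈ Finset.Ico 1 M, ∑ m ∈ Finset.Ico 1 (M - n), shearTerm f b a m n := by
    intro a b
    rw [← sum_sum_swap_triangle (fun n m => shearTerm f b a n m), ← Finset.sum_add_distrib]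
    refine Finset.sum_congr rfl fun n hn => ?_
    rw [← Finset.sum_add_distrib]
    refine Finset.sum_congr rfl fun m hm => ?_
    rw [Finset.mem_Ico] at hn hm
    exact term_eq_shearTerm_add hf a b hm.1 hn.1
  rw [triangleSum]
  simp only [h, Finset.sum_add_distrib]
  rw [Finset.sum_comm (f := fun a b => ∑ n ∈ Finset.Ico 1 M, ∑ m ∈ Finset.Ico 1 (M - n),
    shearTerm f b a m n), sum_shearTerm]
  ring

/-- The combination of the truncated double shuffle relations at an even period polynomial. -/
theorem doubleSum_oddPart {w : ℕ} {p : ZMod N → ZMod N → MvPolynomial (Fin 2) ℚ}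
    (hp : IsEvenPeriod w p) (M : ℕ) :
    doubleSum (oddPart p) M =
      1 / 3 * (squareSum (shiftPart p) M - triangleSum (shiftPart p) M) -
      1 / 3 * diagSum (shiftPart p) M -
      1 / 6 * (squareSum (evenPart p) M - diagSum (evenPart p) M) := by
  rw [hp.oddPart_eq, doubleSum_sub, doubleSum_smul, doubleSum_smul, doubleSum_sub,
    squareSum_eq hp.act_swap_shiftPart, squareSum_eq hp.act_swap_evenPart,
    triangleSum_eq hp.act_swap_shiftPart]
  push_cast
  ring

end Truncated

open Filter Topology Finset

/-! ### Sums of depth one -/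

section DepthOne

/-- The sum of `z_a^m / m^r` over `0 < m < M`. -/
noncomputable def singleSum (N r : ℕ) (a : ZMod N) (M : ℕ) : ℂ :=
  ∑ m ∈ Ico 1 M, zetaN N a ^ m / (m : ℂ) ^ r

theorem norm_zetaN (N : ℕ) [NeZero N] (a : ZMod N) : ‖zetaN N a‖ = 1 := by
  rw [zetaN, norm_pow, Complex.norm_eq_one_of_pow_eq_one (zetaN_pow_card N) (NeZero.ne N), one_pow]

theorem zetaN_pow_eq_one (N : ℕ) [NeZero N] (a : ZMod N) : zetaN N a ^ N = 1 := by
  rw [zetaN, pow_right_comm, zetaN_pow_card, one_pow]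

theorem zetaN_neg {N : ℕ} [NeZero N] (a : ZMod N) : zetaN N (-a) = (zetaN N a)⁻¹ := by
  refine eq_inv_of_mul_eq_one_left ?_
  rw [← zetaN_add, neg_add_cancel, zetaN_zero]

theorem zetaN_ne_one {N : ℕ} [NeZero N] {a : ZMod N} (ha : a ≠ 0) : zetaN N a ≠ 1 := by
  intro h
  have hprim := Complex.isPrimitiveRoot_exp N (NeZero.ne N)
  have h1 := (hprim.pow_eq_one_iff_dvd _).1 h
  have h2 := Nat.eq_zero_of_dvd_of_lt h1 (ZMod.val_lt a)
  exact ha ((ZMod.val_eq_zero a).1 h2)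

/-- `bernoulliFun` takes rational values at rational numbers. -/
theorem exists_bernoulliFun_eq (k : ℕ) (x : ℚ) : ∃ c : ℚ, bernoulliFun k x = c := by
  refine ⟨(Polynomial.bernoulli k).eval x, ?_⟩
  rw [bernoulliFun, Polynomial.eval_map, ← eq_ratCast (algebraMap ℚ ℝ) x,
    Polynomial.eval₂_at_apply, eq_ratCast]

theorem fourier_eq_zetaN_pow {N : ℕ} [NeZero N] (a : ZMod N) (n : ℕ) :
    fourier (n : ℤ) (((a.val / N : ℝ)) : UnitAddCircle) = zetaN N a ^ n := by
  rw [fourier_coe_apply, zetaN, ← pow_mul, ← Complex.exp_nat_mul]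
  congr 1
  push_cast
  ring

theorem fourier_neg_eq_zetaN_pow {N : ℕ} [NeZero N] (a : ZMod N) (n : ℕ) :
    fourier (-(n : ℤ)) (((a.val / N : ℝ)) : UnitAddCircle) = zetaN N (-a) ^ n := by
  rw [fourier_coe_apply, zetaN_neg, inv_pow, zetaN, ← pow_mul, ← Complex.exp_nat_mul,
    ← Complex.exp_neg]
  congr 1
  push_cast
  ring

theorem sum_Ico_one_eq_sum_range {f : ℕ → ℂ} (h : f 0 = 0) (M : ℕ) :
    ∑ m ∈ Ico 1 M, f m = ∑ m ∈ range M, f m := by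
  rcases M with _ | M
  · simp
  · rw [range_eq_Ico, sum_eq_sum_Ico_succ_bot (Nat.succ_pos M), h, zero_add]

/-- The Fourier series of the Bernoulli polynomial B_r, evaluated at the rational point a/N. -/
theorem tendsto_singleSum_parity_of_two_le (N : ℕ) [NeZero N] {r : ℕ} (hr : 2 ≤ r) (a : ZMod N) :
    ∃ c : ℚ, Tendsto (fun M => singleSum N r a M + (-1) ^ r * singleSum N r (-a) M) atTop
      (𝓝 ((c : ℂ) * (2 * Real.pi * Complex.I) ^ r)) := by
  have hN : (0 : ℝ) < N := Nat.cast_pos.2 (NeZero.pos N)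
  have hx : (a.val / N : ℝ) ∈ Set.Icc (0 : ℝ) 1 :=
    ⟨by positivity, by rw [div_le_one hN]; exact_mod_cast (ZMod.val_lt a).le⟩
  obtain ⟨c, hc⟩ := exists_bernoulliFun_eq r (a.val / N : ℚ)
  push_cast at hc
  refine ⟨-c / r !, ?_⟩
  have h := (hasSum_one_div_nat_pow_mul_fourier hr hx).tendsto_sum_nat
  rw [hc] at h
  convert! h using 1
  · funext M
    rw [singleSum, singleSum, mul_sum, ← sum_add_distrib, sum_Ico_one_eq_sum_range]
    · refine sum_congr rfl fun m _ => ?_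
      rw [fourier_eq_zetaN_pow, fourier_neg_eq_zetaN_pow]
      ring
    · simp [show r ≠ 0 by omega]
  · push_cast
    congr 1
    ring

theorem norm_geom_sum_le {z : ℂ} (hz : ‖z‖ = 1) (h1 : z ≠ 1) (n : ℕ) :
    ‖∑ i ∈ range n, z ^ (i + 1)‖ ≤ 2 / ‖z - 1‖ := by
  have : ∑ i ∈ range n, z ^ (i + 1) = z * ((z ^ n - 1) / (z - 1)) := by
    rw [← geom_sum_eq h1, mul_sum]
    exact sum_congr rfl fun i _ => by ring
  rw [this, norm_mul, hz, one_mul, norm_div]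
  gcongr
  calc ‖z ^ n - 1‖ ≤ ‖z ^ n‖ + ‖(1 : ℂ)‖ := norm_sub_le _ _
    _ = 2 := by rw [norm_pow, hz, one_pow, norm_one]; norm_num

/-- Dirichlet's test: the geometric sums are bounded and 1/m decreases to 0. -/
theorem exists_tendsto_sum_pow_div {z : ℂ} (hz : ‖z‖ = 1) (h1 : z ≠ 1) :
    ∃ L, Tendsto (fun M : ℕ => ∑ m ∈ Ico 1 M, z ^ m / (m : ℂ)) atTop (𝓝 L) := by
  have hanti : Antitone fun n : ℕ => (1 : ℝ) / (n + 1) := by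
    intro m n hmn
    dsimp only
    gcongr
  obtain ⟨L, hL⟩ := cauchySeq_tendsto_of_complete
    (hanti.cauchySeq_series_mul_of_tendsto_zero_of_bounded
      tendsto_one_div_add_atTop_nhds_zero_nat (norm_geom_sum_le hz h1))
  refine ⟨L, (hL.comp (tendsto_sub_atTop_nat 1)).congr fun M => ?_⟩
  rw [sum_Ico_eq_sum_range]
  refine sum_congr rfl fun i _ => ?_
  rw [Complex.real_smul, add_comm 1 i]
  push_cast
  ring

/-- Abel's limit theorem identifies the limit; the logarithm is continuous at 1 - z because Re z <
1. -/
theorem tendsto_sum_pow_div {z : ℂ} (hz : ‖z‖ = 1) (h1 : z ≠ 1) :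
    Tendsto (fun M : ℕ => ∑ m ∈ Ico 1 M, z ^ m / (m : ℂ)) atTop (𝓝 (-Complex.log (1 - z))) := by
  obtain ⟨L, hL⟩ := exists_tendsto_sum_pow_div hz h1
  have hL' : Tendsto (fun M : ℕ => ∑ m ∈ range M, z ^ m / (m : ℂ)) atTop (𝓝 L) :=
    hL.congr fun M => sum_Ico_one_eq_sum_range (by simp) M
  have habel := Complex.tendsto_tsum_powerSeries_nhdsWithin_lt hL'
  rw [tendsto_map'_iff] at habel
  have hslit : 1 - z * ((1 : ℝ) : ℂ) ∈ Complex.slitPlane := by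
    left
    have h2 : z.re < 1 := by
      refine lt_of_le_of_ne ((Complex.re_le_norm z).trans hz.le) fun hre => h1 ?_
      have hsq := Complex.sq_norm z
      rw [hz, Complex.normSq_apply, hre] at hsq
      refine Complex.ext hre ?_
      rw [Complex.one_im]
      nlinarith
    simpa using h2
  have hcont : Tendsto (fun x : ℝ => -Complex.log (1 - z * (x : ℂ))) (𝓝[<] 1)
      (𝓝 (-Complex.log (1 - z * ((1 : ℝ) : ℂ)))) := by
    refine Tendsto.mono_left ?_ nhdsWithin_le_nhds
    refine Tendsto.neg (Tendsto.clog ?_ hslit)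
    exact (Continuous.tendsto (by fun_prop) _)
  have heq : (fun x : ℝ => -Complex.log (1 - z * (x : ℂ))) =ᶠ[𝓝[<] 1]
      ((fun w : ℂ => ∑' n : ℕ, z ^ n / (n : ℂ) * w ^ n) ∘ Complex.ofReal) := by
    filter_upwards [Ioo_mem_nhdsLT (show (0 : ℝ) < 1 by norm_num)] with x hx
    have hlt : ‖z * (x : ℂ)‖ < 1 := by
      rw [norm_mul, hz, one_mul, Complex.norm_real, Real.norm_of_nonneg hx.1.le]
      exact hx.2
    rw [← (Complex.hasSum_taylorSeries_neg_log hlt).tsum_eq]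
    refine tsum_congr fun n => ?_
    rw [mul_pow]
    ring
  have hlim := tendsto_nhds_unique (hcont.congr' heq) habel
  rw [Complex.ofReal_one, mul_one] at hlim
  rwa [hlim]

theorem tendsto_singleSum_parity_one (N : ℕ) [NeZero N] (a : ZMod N) :
    ∃ c : ℚ, Tendsto (fun M => singleSum N 1 a M + (-1) ^ 1 * singleSum N 1 (-a) M) atTop
      (𝓝 ((c : ℂ) * (2 * Real.pi * Complex.I) ^ 1)) := by
  by_cases ha : a = 0
  -- The two harmonic sums diverge, but they cancel identically.
  · refine ⟨0, ?_⟩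
    simp [ha]
  · have hz := norm_zetaN N a
    have h1 := zetaN_ne_one ha
    have hz' := norm_zetaN N (-a)
    have h1' := zetaN_ne_one (neg_ne_zero.2 ha)
    set z := zetaN N a with hzdef
    have hz0 : z ≠ 0 := zetaN_ne_zero a
    -- The limit is a logarithm of -1/z, a root of unity of order dividing 2N, hence an integer
    -- multiple of 2πi/(2N).
    have hexp : Complex.exp (-Complex.log (1 - z) + Complex.log (1 - zetaN N (-a))) = -z⁻¹ := by
      rw [Complex.exp_add, Complex.exp_neg, Complex.exp_log (sub_ne_zero.2 h1.symm),
        Complex.exp_log (sub_ne_zero.2 h1'.symm), zetaN_neg]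
      have : 1 - z ≠ 0 := sub_ne_zero.2 h1.symm
      rw [← hzdef]
      field_simp
      ring
    have hpow : Complex.exp ((2 * N : ℕ) *
        (-Complex.log (1 - z) + Complex.log (1 - zetaN N (-a)))) = 1 := by
      rw [Complex.exp_nat_mul, hexp, pow_mul, neg_sq, ← pow_mul, mul_comm, pow_mul, inv_pow,
        zetaN_pow_eq_one, inv_one, one_pow]
    obtain ⟨n, hn⟩ := Complex.exp_eq_one_iff.1 hpow
    refine ⟨n / (2 * N), ?_⟩
    have hlim := (tendsto_sum_pow_div hz h1).sub (tendsto_sum_pow_div hz' h1')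
    have hN : (N : ℂ) ≠ 0 := Nat.cast_ne_zero.2 (NeZero.ne N)
    convert! hlim using 1
    · funext M
      rw [singleSum, singleSum]
      simp only [pow_one]
      ring
    · congr 1
      push_cast at hn ⊢
      rw [pow_one, div_mul_eq_mul_div, ← hn]
      field_simp
      ring

/-- The parity combination of depth one sums converges to a rational multiple of `(2πi)^r`. -/
theorem tendsto_singleSum_parity (N : ℕ) [NeZero N] {r : ℕ} (hr : 1 ≤ r) (a : ZMod N) :
    ∃ c : ℚ, Tendsto (fun M => singleSum N r a M + (-1) ^ r * singleSum N r (-a) M) atTop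
      (𝓝 ((c : ℂ) * (2 * Real.pi * Complex.I) ^ r)) := by
  rcases Nat.lt_or_ge r 2 with h | h
  · obtain rfl : r = 1 := by omega
    exact tendsto_singleSum_parity_one N a
  · exact tendsto_singleSum_parity_of_two_le N h a

end DepthOne

/-! ### Convergence of double sums -/

section Convergence

/-- A crude substitute for the logarithm: it suffices that √n / n² is summable and √M / M tends to
0. -/
theorem sum_one_div_le_sqrt (n : ℕ) : ∑ m ∈ Ico 1 n, (1 : ℝ) / m ≤ 4 * √n := by
  induction n with
  | zero => simp
  | succ n ih =>
    rcases Nat.eq_zero_or_pos n with rfl | hn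
    · simp
    · rw [sum_Ico_succ_top hn]
      have hn1 : (1 : ℝ) ≤ n := by exact_mod_cast hn
      have hx1 : 1 ≤ √(n : ℝ) := Real.one_le_sqrt.2 hn1
      have hx : √(n : ℝ) ^ 2 = n := Real.sq_sqrt (by positivity)
      have hy : √((n + 1 : ℕ) : ℝ) ^ 2 = n + 1 := by
        rw [Real.sq_sqrt (by positivity)]
        push_cast
        ring
      have hy0 : 0 ≤ √((n + 1 : ℕ) : ℝ) := Real.sqrt_nonneg _
      set x := √(n : ℝ)
      set y := √((n + 1 : ℕ) : ℝ)
      have hyx : y ≤ 2 * x := abs_le_of_sq_le_sq' (by nlinarith) (by linarith) |>.2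
      have key : (1 : ℝ) / n ≤ 4 * (y - x) := by
        rw [← hx, div_le_iff₀ (by positivity)]
        by_contra hcon
        push Not at hcon
        -- Since y² - x² = 1, this says 4x² < x + y ≤ 3x, impossible for x ≥ 1.
        have h3 : 4 * (y - x) * x ^ 2 * (y + x) < 1 * (y + x) :=
          mul_lt_mul_of_pos_right hcon (by linarith)
        have h4 : 4 * (y - x) * x ^ 2 * (y + x) = 4 * x ^ 2 := by
          linear_combination 4 * x ^ 2 * (hy - hx)
        nlinarith
      linarith

theorem sum_Ico_one_div_sq_le {k : ℕ} (hk : 1 ≤ k) (n : ℕ) :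
    ∑ m ∈ Ico k n, (1 : ℝ) / (m : ℝ) ^ 2 ≤ 2 / k := by
  have h := sum_Ioo_inv_sq_le (α := ℝ) (k - 1) n
  have h1 : Ioo (k - 1) n = Ico k n := by
    ext x
    simp only [mem_Ioo, mem_Ico]
    omega
  rw [h1, ← Nat.cast_succ, Nat.succ_eq_add_one, Nat.sub_add_cancel hk] at h
  simpa only [one_div] using h

end Convergence

section DoubleConvergence

variable {N : ℕ} [NeZero N]

theorem norm_zetaN_pow_div (a : ZMod N) (r m : ℕ) :
    ‖zetaN N a ^ m / (m : ℂ) ^ r‖ = 1 / (m : ℝ) ^ r := by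
  rw [norm_div, norm_pow, norm_zetaN, one_pow, norm_pow, Complex.norm_natCast]

theorem norm_singleSum_le {r : ℕ} (hr : 1 ≤ r) (a : ZMod N) (n : ℕ) :
    ‖singleSum N r a n‖ ≤ 4 * √n := by
  refine le_trans ?_ (sum_one_div_le_sqrt n)
  refine norm_sum_le_of_le _ fun m hm => ?_
  rw [norm_zetaN_pow_div]
  have h1 : (1 : ℝ) ≤ m := by exact_mod_cast (mem_Ico.1 hm).1
  gcongr
  exact le_self_pow₀ h1 (by omega)

theorem exists_tendsto_singleSum {r : ℕ} (hr : 2 ≤ r) (a : ZMod N) :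
    ∃ L, Tendsto (singleSum N r a) atTop (𝓝 L) ∧ ∀ n, 1 ≤ n → ‖singleSum N r a n - L‖ ≤ 2 / n := by
  have hsum : Summable fun m : ℕ => zetaN N a ^ m / (m : ℂ) ^ r := by
    refine Summable.of_norm ?_
    simp only [norm_zetaN_pow_div]
    exact Real.summable_one_div_nat_pow.2 (by omega)
  have hL : Tendsto (singleSum N r a) atTop (𝓝 (∑' m : ℕ, zetaN N a ^ m / (m : ℂ) ^ r)) := by
    refine hsum.hasSum.tendsto_sum_nat.congr fun M => ?_
    rw [singleSum, sum_Ico_one_eq_sum_range]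
    simp [show r ≠ 0 by omega]
  refine ⟨_, hL, fun n hn => ?_⟩
  refine le_of_tendsto (tendsto_const_nhds.sub hL).norm ?_
  filter_upwards [eventually_ge_atTop n] with M hM
  rw [norm_sub_rev, singleSum, singleSum, ← sum_Ico_consecutive _ hn hM, add_sub_cancel_left]
  refine (norm_sum_le_of_le _ fun m hm => ?_).trans (sum_Ico_one_div_sq_le hn M)
  rw [norm_zetaN_pow_div]
  have h1 : (1 : ℝ) ≤ m := by exact_mod_cast hn.trans (mem_Ico.1 hm).1
  gcongr

omit [NeZero N] in
theorem truncSum_pair (r s : ℕ) (a b : ZMod N) (M : ℕ) : truncSum N [(s, b), (r, a)] M =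
    ∑ n ∈ Ico 1 M, zetaN N b ^ n / (n : ℂ) ^ s * singleSum N r a n := by
  simp only [truncSum, mul_one, singleSum]

theorem exists_tendsto_sum_Ico_of_summable {u : ℕ → ℂ} (hu : Summable u) (h0 : u 0 = 0) :
    ∃ L, Tendsto (fun M => ∑ n ∈ Ico 1 M, u n) atTop (𝓝 L) :=
  ⟨_, hu.hasSum.tendsto_sum_nat.congr fun M => (sum_Ico_one_eq_sum_range h0 M).symm⟩

theorem summable_sqrt_div_sq : Summable fun n : ℕ => √(n : ℝ) / (n : ℝ) ^ 2 := by
  refine (Real.summable_one_div_nat_rpow (p := 3 / 2)|>.2 (by norm_num)).congr fun n => ?_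
  rcases Nat.eq_zero_or_pos n with rfl | hn
  · simp
  · have hn' : (0 : ℝ) < n := by exact_mod_cast hn
    rw [div_eq_div_iff (by positivity) (by positivity), one_mul, Real.sqrt_eq_rpow,
      ← Real.rpow_add hn', ← Real.rpow_natCast]
    norm_num

/-- The double series of weight at least three converge outside the divergent index. -/
theorem exists_tendsto_truncSum {r s : ℕ} (hr : 1 ≤ r) (hs : 1 ≤ s) (hrs : 3 ≤ r + s)
    (a : ZMod N) {b : ZMod N} (hb : s = 1 → b ≠ 0) :
    ∃ L, Tendsto (truncSum N [(s, b), (r, a)]) atTop (𝓝 L) := by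
  suffices h : ∃ L, Tendsto (fun M : ℕ => ∑ n ∈ Ico 1 M, zetaN N b ^ n / (n : ℂ) ^ s *
      singleSum N r a n) atTop (𝓝 L) by
    obtain ⟨L, hL⟩ := h
    exact ⟨L, hL.congr fun M => (truncSum_pair r s a b M).symm⟩
  rcases Nat.lt_or_ge s 2 with h | h
  · obtain rfl : s = 1 := by omega
    obtain ⟨L, -, hL⟩ := exists_tendsto_singleSum (show 2 ≤ r by omega) a
    obtain ⟨L₁, hL₁⟩ := exists_tendsto_sum_pow_div (norm_zetaN N b) (zetaN_ne_one (hb rfl))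
    -- Subtracting the limit L of the inner sum leaves an absolutely convergent series; L times the
    -- rest converges conditionally because z_b ≠ 1.
    have hsum : Summable fun n : ℕ => zetaN N b ^ n / (n : ℂ) ^ 1 * (singleSum N r a n - L) := by
      refine Summable.of_norm_bounded
        ((Real.summable_one_div_nat_pow.2 (show 1 < 2 by norm_num)).mul_left 2) fun n => ?_
      rw [norm_mul, norm_zetaN_pow_div]
      rcases Nat.eq_zero_or_pos n with rfl | hn
      · simp
      · calc 1 / (n : ℝ) ^ 1 * ‖singleSum N r a n - L‖ ≤ 1 / (n : ℝ) ^ 1 * (2 / n) := by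
              gcongr
              exact hL n hn
          _ = 2 * (1 / (n : ℝ) ^ 2) := by ring
    obtain ⟨L₂, hL₂⟩ := exists_tendsto_sum_Ico_of_summable hsum (by simp)
    refine ⟨_, (hL₂.add (hL₁.const_mul L)).congr fun M => ?_⟩
    rw [mul_sum, ← sum_add_distrib]
    refine sum_congr rfl fun n _ => ?_
    ring
  · refine exists_tendsto_sum_Ico_of_summable ?_ (by simp [show s ≠ 0 by omega])
    refine Summable.of_norm_bounded (summable_sqrt_div_sq.mul_left 4) fun n => ?_
    rw [norm_mul, norm_zetaN_pow_div]
    rcases Nat.eq_zero_or_pos n with rfl | hn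
    · simp [show s ≠ 0 by omega]
    · have h1 : (1 : ℝ) ≤ n := by exact_mod_cast hn
      calc 1 / (n : ℝ) ^ s * ‖singleSum N r a n‖ ≤ 1 / (n : ℝ) ^ 2 * (4 * √n) := by
            gcongr
            exact norm_singleSum_le hr a n
        _ = 4 * (√n / (n : ℝ) ^ 2) := by ring

end DoubleConvergence

/-! ### The difference of the square and the triangle -/

section Triangle

theorem sum_Ico_one_div_reflect (M : ℕ) :
    ∑ n ∈ Ico 1 M, (1 : ℝ) / ((M - n : ℕ) : ℝ) = ∑ n ∈ Ico 1 M, (1 : ℝ) / n := by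
  refine sum_nbij' (fun n => M - n) (fun n => M - n) ?_ ?_ ?_ ?_ ?_ <;>
  · intro n hn
    simp only [mem_Ico] at hn ⊢
    try omega

/-- The tail of 1/m² from M - n on is at most 2/(M - n), and 1/(n(M - n)) = (1/n + 1/(M - n))/M
reduces the rest to harmonic sums. -/
theorem sum_corner_le (M : ℕ) :
    ∑ n ∈ Ico 1 M, ∑ m ∈ Ico (M - n) M, (1 : ℝ) / ((m : ℝ) ^ 2 * n) ≤ 16 / √M := by
  rcases Nat.eq_zero_or_pos M with rfl | hM
  · simp
  have hM' : (0 : ℝ) < M := by exact_mod_cast hM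
  calc ∑ n ∈ Ico 1 M, ∑ m ∈ Ico (M - n) M, (1 : ℝ) / ((m : ℝ) ^ 2 * n)
      ≤ ∑ n ∈ Ico 1 M, 2 / (M : ℝ) * (1 / n + 1 / ((M - n : ℕ) : ℝ)) := by
        refine sum_le_sum fun n hn => ?_
        rw [mem_Ico] at hn
        have hn0 : (0 : ℝ) < n := by exact_mod_cast hn.1
        have hn1 : (0 : ℝ) < M - n := sub_pos.2 (by exact_mod_cast hn.2)
        have h := sum_Ico_one_div_sq_le (show 1 ≤ M - n by omega) M
        rw [Nat.cast_sub hn.2.le] at h ⊢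
        calc ∑ m ∈ Ico (M - n) M, (1 : ℝ) / ((m : ℝ) ^ 2 * n)
            = (∑ m ∈ Ico (M - n) M, (1 : ℝ) / (m : ℝ) ^ 2) * (1 / n) := by
              rw [sum_mul]
              exact sum_congr rfl fun m _ => by rw [div_mul_div_comm, one_mul]
          _ ≤ 2 / ((M : ℝ) - n) * (1 / n) := by gcongr
          _ = 2 / (M : ℝ) * (1 / n + 1 / ((M : ℝ) - n)) := by
              field_simp
              ring
    _ = 4 / (M : ℝ) * ∑ n ∈ Ico 1 M, (1 : ℝ) / n := by
        rw [← mul_sum, sum_add_distrib, sum_Ico_one_div_reflect]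
        ring
    _ ≤ 4 / (M : ℝ) * (4 * √M) := by
        gcongr
        exact sum_one_div_le_sqrt M
    _ = 16 / √M := by
        have hs : √(M : ℝ) ≠ 0 := (Real.sqrt_pos.2 hM').ne'
        have := Real.sq_sqrt hM'.le
        rw [eq_div_iff hs]
        nth_rewrite 1 [← this]
        field_simp
        norm_num

theorem sum_corner_swap (G : ℕ → ℕ → ℝ) (M : ℕ) :
    ∑ n ∈ Ico 1 M, ∑ m ∈ Ico (M - n) M, G n m = ∑ n ∈ Ico 1 M, ∑ m ∈ Ico (M - n) M, G m n := by
  rw [sum_comm' (t' := Ico 1 M) (s' := fun n => Ico (M - n) M)]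
  intro x y
  simp only [mem_Ico]
  omega

/-- Since w ≥ 1, in each monomial one of the two exponents of m and n is at least 2. -/
theorem exists_norm_laplace_le {w : ℕ} (hw : 1 ≤ w) {f : MvPolynomial (Fin 2) ℚ}
    (hf : f.IsHomogeneous w) : ∃ C : ℝ, ∀ m n : ℕ, 1 ≤ m → 1 ≤ n →
      ‖laplace m n f‖ ≤ C * (1 / ((m : ℝ) ^ 2 * n) + 1 / ((n : ℝ) ^ 2 * m)) := by
  refine ⟨∑ e ∈ HasAntidiagonal.antidiagonal w,
    ‖(binCoeff e.1 e.2 f : ℂ)‖ * ((e.1 ! : ℝ) * (e.2 ! : ℝ)), fun m n hm hn => ?_⟩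
  rw [laplace_eq_sum _ _ hf, sum_mul]
  refine norm_sum_le_of_le _ fun e he => ?_
  have hm1 : (1 : ℝ) ≤ m := by exact_mod_cast hm
  have hn1 : (1 : ℝ) ≤ n := by exact_mod_cast hn
  rw [norm_mul, norm_div, norm_mul, norm_mul, norm_pow, norm_pow, Complex.norm_natCast,
    Complex.norm_natCast, Complex.norm_natCast, Complex.norm_natCast, mul_assoc,
    div_eq_mul_one_div]
  refine mul_le_mul_of_nonneg_left (mul_le_mul_of_nonneg_left ?_ (by positivity)) (norm_nonneg _)
  rw [HasAntidiagonal.mem_antidiagonal] at he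
  rcases Nat.eq_zero_or_pos e.1 with h | h
  · refine le_add_of_nonneg_of_le (by positivity) ?_
    rw [h, zero_add, pow_one, mul_comm]
    gcongr
    omega
  · refine le_add_of_le_of_nonneg ?_ (by positivity)
    gcongr
    · omega
    · exact le_self_pow₀ hn1 (by omega)

theorem tendsto_sum_corner_term {N : ℕ} [NeZero N] {w : ℕ} (hw : 1 ≤ w)
    {f : ZMod N → ZMod N → MvPolynomial (Fin 2) ℚ} (hf : ∀ a b, (f a b).IsHomogeneous w)
    (a b : ZMod N) :
    Tendsto (fun M => ∑ n ∈ Ico 1 M, ∑ m ∈ Ico (M - n) M, term f a b m n) atTop (𝓝 0) := by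
  obtain ⟨C, hC⟩ := exists_norm_laplace_le hw (hf a b)
  have hC0 : 0 ≤ C := by
    have h := (norm_nonneg _).trans (hC 1 1 le_rfl le_rfl)
    norm_num at h
    exact h
  refine squeeze_zero_norm (a := fun M : ℕ => C * (16 / √(M : ℝ) + 16 / √(M : ℝ))) (fun M => ?_) ?_
  · calc ‖∑ n ∈ Ico 1 M, ∑ m ∈ Ico (M - n) M, term f a b m n‖
        ≤ ∑ n ∈ Ico 1 M, ∑ m ∈ Ico (M - n) M,
          C * (1 / ((m : ℝ) ^ 2 * n) + 1 / ((n : ℝ) ^ 2 * m)) := by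
          refine norm_sum_le_of_le _ fun n hn => norm_sum_le_of_le _ fun m hm => ?_
          rw [mem_Ico] at hn hm
          rw [term, norm_mul, norm_mul, norm_pow, norm_pow, norm_zetaN, norm_zetaN, one_pow,
            one_pow, one_mul, one_mul]
          exact hC m n (by omega) hn.1
      _ = C * (∑ n ∈ Ico 1 M, ∑ m ∈ Ico (M - n) M, 1 / ((m : ℝ) ^ 2 * n) +
          ∑ n ∈ Ico 1 M, ∑ m ∈ Ico (M - n) M, 1 / ((m : ℝ) ^ 2 * n)) := by
          simp only [← mul_sum, sum_add_distrib]
          rw [sum_corner_swap fun n m => 1 / ((n : ℝ) ^ 2 * m)]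
      _ ≤ C * (16 / √(M : ℝ) + 16 / √(M : ℝ)) := by
          gcongr <;> exact sum_corner_le M
  · have h : Tendsto (fun M : ℕ => 16 / √(M : ℝ)) atTop (𝓝 0) :=
      tendsto_const_nhds.div_atTop
        (Real.tendsto_sqrt_atTop.comp tendsto_natCast_atTop_atTop)
    simpa using (h.add h).const_mul C

/-- The difference is the sum over the corner m + n ≥ M of the square. -/
theorem tendsto_squareSum_sub_triangleSum {N : ℕ} [NeZero N] {w : ℕ} (hw : 1 ≤ w)
    {f : ZMod N → ZMod N → MvPolynomial (Fin 2) ℚ} (hf : ∀ a b, (f a b).IsHomogeneous w) :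
    Tendsto (fun M => squareSum f M - triangleSum f M) atTop (𝓝 0) := by
  have h := tendsto_finsetSum (univ : Finset (ZMod N)) fun a _ =>
    tendsto_finsetSum (univ : Finset (ZMod N)) fun b _ => tendsto_sum_corner_term hw hf a b
  simp only [sum_const_zero] at h
  refine h.congr fun M => ?_
  rw [squareSum, triangleSum, ← sum_sub_distrib]
  refine sum_congr rfl fun a _ => ?_
  rw [← sum_sub_distrib]
  refine sum_congr rfl fun b _ => ?_
  rw [← sum_sub_distrib]
  refine sum_congr rfl fun n hn => ?_
  rw [mem_Ico] at hn
  rw [← sum_Ico_consecutive _ (show 1 ≤ M - n by omega) (show M - n ≤ M by omega),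
    add_sub_cancel_left]

end Triangle

/-! ### Limits that are rational multiples of powers of `2πi` -/

section RationalLimit

/-- The sequence `u` converges to a rational multiple of `(2πi)^k`. -/
def HasRationalLimit (k : ℕ) (u : ℕ → ℂ) : Prop :=
  ∃ c : ℚ, Tendsto u atTop (𝓝 ((c : ℂ) * (2 * Real.pi * Complex.I) ^ k))

namespace HasRationalLimit

variable {k l : ℕ} {u v : ℕ → ℂ}

theorem add (hu : HasRationalLimit k u) (hv : HasRationalLimit k v) :
    HasRationalLimit k fun M => u M + v M := by
  obtain ⟨c, hc⟩ := hu
  obtain ⟨d, hd⟩ := hv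
  refine ⟨c + d, ?_⟩
  push_cast
  rw [add_mul]
  exact hc.add hd

theorem const_mul (hu : HasRationalLimit k u) (r : ℚ) :
    HasRationalLimit k fun M => (r : ℂ) * u M := by
  obtain ⟨c, hc⟩ := hu
  refine ⟨r * c, ?_⟩
  push_cast
  rw [mul_assoc]
  exact hc.const_mul _

theorem mul (hu : HasRationalLimit k u) (hv : HasRationalLimit l v) :
    HasRationalLimit (k + l) fun M => u M * v M := by
  obtain ⟨c, hc⟩ := hu
  obtain ⟨d, hd⟩ := hv
  refine ⟨c * d, ?_⟩
  push_cast
  rw [pow_add, mul_mul_mul_comm]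
  exact hc.mul hd

theorem sum {ι : Type*} {s : Finset ι} {u : ι → ℕ → ℂ}
    (h : ∀ i ∈ s, HasRationalLimit k (u i)) : HasRationalLimit k fun M => ∑ i ∈ s, u i M := by
  classical
  induction s using Finset.induction_on with
  | empty =>
    refine ⟨0, ?_⟩
    simp
  | insert i s hi ih =>
    simp only [sum_insert hi]
    exact (h i (mem_insert_self i s)).add (ih fun j hj => h j (mem_insert_of_mem hj))

end HasRationalLimit

end RationalLimit

/-! ### Parity of the coefficients and the limits of square and diagonal sums -/

section Symmetrization

/-- Symmetrization of a sum with coefficients of given parity. -/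
theorem two_mul_sum_of_parity {ι : Type*} [Fintype ι] [InvolutiveNeg ι] (c S : ι → ℂ) (s : ℂ)
    (hc : ∀ i, c (-i) = s * c i) : 2 * ∑ i, c i * S i = ∑ i, c i * (S i + s * S (-i)) := by
  have h : ∑ i, c i * S i = ∑ i, c i * (s * S (-i)) := by
    rw [← Equiv.sum_comp (Equiv.neg ι)]
    refine sum_congr rfl fun i _ => ?_
    rw [Equiv.neg_apply, hc]
    ring
  simp only [mul_add, sum_add_distrib]
  rw [two_mul, ← h]

variable {N w : ℕ} {f : ZMod N → ZMod N → MvPolynomial (Fin 2) ℚ}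

theorem binCoeff_neg_neg (hf : ∀ a b, (f a b).IsHomogeneous w) (hJ : act (-1) f = f)
    (i j : ℕ) (a b : ZMod N) :
    binCoeff i j (f (-a) (-b)) = (-1) ^ w * binCoeff i j (f a b) := by
  have h : f a b = (-1) ^ w * f (-a) (-b) := by
    have h1 : act (-1) f a b = slash (-1) (f (-a) (-b)) := by simp [act]
    rw [hJ, slash_neg _ (hf _ _), slash_one] at h1
    exact h1
  have h1 : ((-1) ^ w : MvPolynomial (Fin 2) ℚ) = MvPolynomial.C ((-1) ^ w) := by simp
  rw [h, h1, ← MvPolynomial.smul_eq_C_mul, map_smul, smul_eq_mul, ← mul_assoc, ← mul_pow]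
  simp

/-- The sign is (-1)^r for the depth one weight r = i + 1, as the symmetrization of S_r(a) requires.
-/
theorem binCoeff_neg_left (hε : act eps f = -f) (i j : ℕ) (a b : ZMod N) :
    binCoeff i j (f (-a) b) = (-1) ^ (i + 1) * binCoeff i j (f a b) := by
  have h : slash eps (f (-a) b) = -f a b := by
    rw [← Pi.neg_apply, ← Pi.neg_apply, ← hε]
    simp [act, eps]
  have h1 := congrArg (binCoeff i j) h
  rw [binCoeff_slash_eps, map_neg] at h1
  have h2 : ((-1 : ℚ) ^ i) * (-1) ^ i = 1 := by rw [← mul_pow]; simp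
  linear_combination (-1 : ℚ) ^ i * h1 - binCoeff i j (f (-a) b) * h2

theorem binCoeff_neg_right (hf : ∀ a b, (f a b).IsHomogeneous w) (hJ : act (-1) f = f)
    (hε : act eps f = -f) {i j : ℕ} (hij : i + j = w) (a b : ZMod N) :
    binCoeff i j (f a (-b)) = (-1) ^ (j + 1) * binCoeff i j (f a b) := by
  have h1 := binCoeff_neg_left hε i j (-a) (-b)
  rw [neg_neg, binCoeff_neg_neg hf hJ] at h1
  rw [h1, ← hij]
  have h2 : ((-1 : ℚ) ^ i) * (-1) ^ i = 1 := by rw [← mul_pow]; simp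
  rw [pow_add, pow_add, pow_add, pow_one]
  linear_combination -binCoeff i j (f a b) * (-1) ^ j * h2

/-- The coefficients in the pairing of `f` with double sums. -/
noncomputable def pairCoeff (f : ZMod N → ZMod N → MvPolynomial (Fin 2) ℚ) (e : ℕ × ℕ)
    (a b : ZMod N) : ℚ :=
  binCoeff e.1 e.2 (f a b) * ((e.1 ! : ℚ) * (e.2 ! : ℚ))

theorem term_eq_sum (hf : ∀ a b, (f a b).IsHomogeneous w) (a b : ZMod N) (m n : ℕ) :
    term f a b m n = ∑ e ∈ HasAntidiagonal.antidiagonal w, (pairCoeff f e a b : ℂ) *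
      (zetaN N a ^ m / (m : ℂ) ^ (e.1 + 1) * (zetaN N b ^ n / (n : ℂ) ^ (e.2 + 1))) := by
  rw [term, laplace_eq_sum _ _ (hf a b), mul_sum]
  refine sum_congr rfl fun e _ => ?_
  rw [pairCoeff]
  push_cast
  rw [div_mul_div_comm]
  ring

theorem sum_sum_sum_comm {ι κ μ : Type*} (s : Finset ι) (t : ι → Finset κ) (r : Finset μ)
    (F : ι → κ → μ → ℂ) :
    ∑ i ∈ s, ∑ j ∈ t i, ∑ k ∈ r, F i j k = ∑ k ∈ r, ∑ i ∈ s, ∑ j ∈ t i, F i j k :=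
  (sum_congr rfl fun _ _ => sum_comm).trans sum_comm

variable [NeZero N]

theorem doubleSum_eq_sum (hf : ∀ a b, (f a b).IsHomogeneous w) (M : ℕ) :
    doubleSum f M = ∑ e ∈ HasAntidiagonal.antidiagonal w, ∑ a, ∑ b, (pairCoeff f e a b : ℂ) *
      truncSum N [(e.2 + 1, b), (e.1 + 1, a)] M := by
  rw [← sum_sum_sum_comm, doubleSum]
  refine sum_congr rfl fun a _ => sum_congr rfl fun b _ => ?_
  simp only [term_eq_sum hf]
  rw [sum_sum_sum_comm]
  refine sum_congr rfl fun e _ => ?_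
  simp only [truncSum_pair, singleSum, mul_sum]
  refine sum_congr rfl fun n _ => sum_congr rfl fun m _ => ?_
  ring

theorem squareSum_eq_sum (hf : ∀ a b, (f a b).IsHomogeneous w) (M : ℕ) :
    squareSum f M = ∑ e ∈ HasAntidiagonal.antidiagonal w, ∑ a, ∑ b, (pairCoeff f e a b : ℂ) *
      (singleSum N (e.1 + 1) a M * singleSum N (e.2 + 1) b M) := by
  rw [← sum_sum_sum_comm, squareSum]
  refine sum_congr rfl fun a _ => sum_congr rfl fun b _ => ?_
  simp only [term_eq_sum hf]
  rw [sum_sum_sum_comm]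
  refine sum_congr rfl fun e _ => ?_
  rw [singleSum, singleSum, sum_mul_sum, mul_sum, sum_comm]
  simp only [mul_sum]

theorem diagSum_eq_sum (hf : ∀ a b, (f a b).IsHomogeneous w) (M : ℕ) :
    diagSum f M = ∑ e ∈ HasAntidiagonal.antidiagonal w, ∑ p : ZMod N × ZMod N,
      (pairCoeff f e p.1 p.2 : ℂ) * singleSum N (w + 2) (p.1 + p.2) M := by
  simp only [Fintype.sum_prod_type]
  rw [← sum_sum_sum_comm, diagSum]
  refine sum_congr rfl fun a _ => sum_congr rfl fun b _ => ?_
  simp only [term_eq_sum hf]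
  rw [sum_comm]
  refine sum_congr rfl fun e he => ?_
  rw [singleSum, mul_sum]
  refine sum_congr rfl fun n _ => ?_
  rw [HasAntidiagonal.mem_antidiagonal] at he
  rw [zetaN_add, mul_pow, ← he, show e.1 + e.2 + 2 = e.1 + 1 + (e.2 + 1) by ring,
    pow_add _ (e.1 + 1), div_mul_div_comm]

/-- The coefficients have a parity in a and in b separately, so each factor S_r(a) may be replaced
by half of S_r(a) + (-1)^r S_r(-a). This also removes the divergent sum S_1(0). -/
theorem hasRationalLimit_squareSum (hf : ∀ a b, (f a b).IsHomogeneous w) (hJ : act (-1) f = f)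
    (hε : act eps f = -f) : HasRationalLimit (w + 2) (squareSum f) := by
  have key : ∀ M, squareSum f M = ∑ e ∈ HasAntidiagonal.antidiagonal w, ∑ a, ∑ b,
      ((pairCoeff f e a b / 4 : ℚ) : ℂ) *
        ((singleSum N (e.1 + 1) a M + (-1) ^ (e.1 + 1) * singleSum N (e.1 + 1) (-a) M) *
        (singleSum N (e.2 + 1) b M + (-1) ^ (e.2 + 1) * singleSum N (e.2 + 1) (-b) M)) := by
    intro M
    rw [squareSum_eq_sum hf]
    refine sum_congr rfl fun e he => ?_
    rw [HasAntidiagonal.mem_antidiagonal] at he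
    have h1 : ∀ a, 2 * ∑ b, (pairCoeff f e a b : ℂ) * singleSum N (e.2 + 1) b M =
        ∑ b, (pairCoeff f e a b : ℂ) *
          (singleSum N (e.2 + 1) b M + (-1) ^ (e.2 + 1) * singleSum N (e.2 + 1) (-b) M) := by
      intro a
      refine two_mul_sum_of_parity _ _ _ fun b => ?_
      rw [pairCoeff, pairCoeff, binCoeff_neg_right hf hJ hε he]
      push_cast
      ring
    have h2 : ∀ b, 2 * ∑ a, (pairCoeff f e a b : ℂ) * singleSum N (e.1 + 1) a M =
        ∑ a, (pairCoeff f e a b : ℂ) *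
          (singleSum N (e.1 + 1) a M + (-1) ^ (e.1 + 1) * singleSum N (e.1 + 1) (-a) M) := by
      intro b
      refine two_mul_sum_of_parity _ _ _ fun a => ?_
      rw [pairCoeff, pairCoeff, binCoeff_neg_left hε]
      push_cast
      ring
    generalize (fun a => singleSum N (e.1 + 1) a M +
      (-1) ^ (e.1 + 1) * singleSum N (e.1 + 1) (-a) M) = E₁ at h2
    calc ∑ a, ∑ b, (pairCoeff f e a b : ℂ) *
          (singleSum N (e.1 + 1) a M * singleSum N (e.2 + 1) b M)
        = 1 / 2 * ∑ a, singleSum N (e.1 + 1) a M *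
            (2 * ∑ b, (pairCoeff f e a b : ℂ) * singleSum N (e.2 + 1) b M) := by
          simp only [mul_sum]
          refine sum_congr rfl fun a _ => sum_congr rfl fun b _ => ?_
          ring
      _ = 1 / 4 * ∑ b, (2 * ∑ a, (pairCoeff f e a b : ℂ) * singleSum N (e.1 + 1) a M) *
            (singleSum N (e.2 + 1) b M + (-1) ^ (e.2 + 1) * singleSum N (e.2 + 1) (-b) M) := by
          simp only [h1]
          simp only [mul_sum, sum_mul]
          rw [sum_comm]
          refine sum_congr rfl fun b _ => sum_congr rfl fun a _ => ?_
          ring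
      _ = _ := by
          simp only [h2]
          simp only [mul_sum, sum_mul]
          rw [sum_comm]
          refine sum_congr rfl fun a _ => sum_congr rfl fun b _ => ?_
          push_cast
          ring
  have h : HasRationalLimit (w + 2) fun M => ∑ e ∈ HasAntidiagonal.antidiagonal w, ∑ a, ∑ b,
      ((pairCoeff f e a b / 4 : ℚ) : ℂ) *
        ((singleSum N (e.1 + 1) a M + (-1) ^ (e.1 + 1) * singleSum N (e.1 + 1) (-a) M) *
        (singleSum N (e.2 + 1) b M + (-1) ^ (e.2 + 1) * singleSum N (e.2 + 1) (-b) M)) := by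
    refine .sum fun e he => .sum fun a _ => .sum fun b _ => .const_mul ?_ _
    rw [HasAntidiagonal.mem_antidiagonal] at he
    rw [show w + 2 = e.1 + 1 + (e.2 + 1) by omega]
    exact HasRationalLimit.mul (tendsto_singleSum_parity N (by omega) a)
      (tendsto_singleSum_parity N (by omega) b)
  rwa [show squareSum f = _ from funext key]

/-- The diagonal depends only on z_{a+b}, so the joint parity under (a, b) ↦ (-a, -b) suffices; its
sign (-1)^w matches the weight w + 2. -/
theorem hasRationalLimit_diagSum (hf : ∀ a b, (f a b).IsHomogeneous w) (hJ : act (-1) f = f) :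
    HasRationalLimit (w + 2) (diagSum f) := by
  have key : ∀ M, diagSum f M = ∑ e ∈ HasAntidiagonal.antidiagonal w, ∑ p : ZMod N × ZMod N,
      ((pairCoeff f e p.1 p.2 / 2 : ℚ) : ℂ) * (singleSum N (w + 2) (p.1 + p.2) M +
        (-1) ^ (w + 2) * singleSum N (w + 2) (-(p.1 + p.2)) M) := by
    intro M
    rw [diagSum_eq_sum hf]
    refine sum_congr rfl fun e he => ?_
    have h := two_mul_sum_of_parity (fun p : ZMod N × ZMod N => (pairCoeff f e p.1 p.2 : ℂ))
      (fun p => singleSum N (w + 2) (p.1 + p.2) M) ((-1) ^ (w + 2)) fun p => by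
        rw [pairCoeff, pairCoeff, Prod.fst_neg, Prod.snd_neg, binCoeff_neg_neg hf hJ]
        push_cast
        ring
    rw [← mul_right_inj' (two_ne_zero (α := ℂ)), h, mul_sum]
    refine sum_congr rfl fun p _ => ?_
    rw [Prod.fst_neg, Prod.snd_neg, neg_add]
    push_cast
    ring
  rw [show diagSum f = _ from funext key]
  exact .sum fun e he => .sum fun p _ => .const_mul (tendsto_singleSum_parity N (by omega) _) _

/-- The pairing of the odd part of an even period polynomial with truncated double sums converges
to a rational multiple of `(2πi)^(w+2)`. -/
theorem hasRationalLimit_doubleSum_oddPart (hw : 1 ≤ w)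
    {p : ZMod N → ZMod N → MvPolynomial (Fin 2) ℚ} (hp : IsEvenPeriod w p) :
    HasRationalLimit (w + 2) (doubleSum (oddPart p)) := by
  have hU : ∀ a b, (act mU p a b).IsHomogeneous w := fun a b =>
    isHomogeneous_slash _ (hp.homogeneous _ _)
  have hs : ∀ a b, (shiftPart p a b).IsHomogeneous w := fun a b => by
    have := (hU a b).add ((hp.homogeneous a b).C_mul (1 / 2))
    rwa [← MvPolynomial.smul_eq_C_mul] at this
  have he : ∀ a b, (evenPart p a b).IsHomogeneous w := fun a b => by
    have := ((hU a b).sub (isHomogeneous_slash eps (hU (eps 0 0 * a + eps 0 1 * b)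
      (eps 1 0 * a + eps 1 1 * b)))).C_mul (1 / 2)
    rwa [← MvPolynomial.smul_eq_C_mul] at this
  have h0 : HasRationalLimit (w + 2)
      fun M => squareSum (shiftPart p) M - triangleSum (shiftPart p) M :=
    ⟨0, by simpa using tendsto_squareSum_sub_triangleSum hw hs⟩
  have h := ((h0.const_mul (1 / 3)).add ((hasRationalLimit_diagSum hs
    hp.act_neg_one_shiftPart).const_mul (-1 / 3))).add
    (((hasRationalLimit_squareSum he hp.act_neg_one_evenPart
      IsEvenPeriod.act_eps_evenPart).add ((hasRationalLimit_diagSum he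
      hp.act_neg_one_evenPart).const_mul (-1))).const_mul (-1 / 6))
  convert! h using 1
  funext M
  rw [doubleSum_oddPart hp]
  push_cast
  ring

end Symmetrization

/-! ### Convergent shuffle regularized values -/

section ShuffleZeta

variable {N : ℕ}

theorem ofWord_replicate (c : ZMod N) (k j : ℕ) (l : List (Letter N)) :
    ofWord c k (List.replicate j none ++ l) = ofWord c (k + j) l := by
  induction j generalizing k with
  | zero => simp
  | succ j ih =>
    rw [List.replicate_succ, List.cons_append, ofWord, ih]
    congr 1
    ring

/-- The word does not begin with dt/(1 - t), so nothing is split off, and `ofWord` recovers the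
index from it. -/
theorem shuffleZeta_of_convergent {r s : ℕ} (hr : 1 ≤ r) (hs : 1 ≤ s) (a : ZMod N) {b : ZMod N}
    (hb : s = 1 → b ≠ 0) :
    shuffleZeta N [(r, a), (s, b)] = Polynomial.C (zetaRev N [(s, b), (r, a)]) := by
  have hword : toWord 0 [(r, a), (s, b)].reverse =
      List.replicate (s - 1) none ++ some b ::
        (List.replicate (r - 1) none ++ [some (b + a)]) := by
    simp [toWord]
  have hof : ofWord 0 1 (toWord 0 [(r, a), (s, b)].reverse) = [(s, b), (r, a)] := by
    rw [hword, ofWord_replicate, ofWord, ofWord_replicate, ofWord, ofWord, sub_zero,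
      add_sub_cancel_left, Nat.add_sub_cancel' hs, Nat.add_sub_cancel' hr]
  have hhead : ∃ x l, toWord 0 [(r, a), (s, b)].reverse = x :: l ∧ x ≠ some (0 : ZMod N) := by
    rw [hword]
    rcases Nat.lt_or_ge s 2 with h | h
    · obtain rfl : s = 1 := by omega
      exact ⟨_, _, rfl, by simpa using hb rfl⟩
    · obtain ⟨j, rfl⟩ := Nat.exists_eq_add_of_le' h
      exact ⟨none, _, rfl, by simp⟩
  obtain ⟨x, l, hxl, hx⟩ := hhead
  rw [shuffleZeta]
  rw [hxl] at hof ⊢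
  simp only [List.takeWhile_cons, List.dropWhile_cons, hx, decide_false, if_false,
    List.length_nil, shuffleReg, hof, Bool.false_eq_true]

end ShuffleZeta

/-! ### The coefficients of the odd part -/

section Coefficients

open MvPolynomial in
theorem aeval_slash (v : Fin 2 → ℚ) (γ : Matrix (Fin 2) (Fin 2) ℤ) (f : MvPolynomial (Fin 2) ℚ) :
    aeval v (slash γ f) =
      aeval (fun i => (γ i 0 : ℚ) * v 0 + (γ i 1 : ℚ) * v 1) f := by
  rw [slash_eq_slashHom, ← AlgHom.comp_apply]
  congr 1
  refine MvPolynomial.algHom_ext fun i => ?_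
  simp [slashHom_X]

open MvPolynomial in
theorem binCoeff_zero_right_eq_aeval {w : ℕ} {f : MvPolynomial (Fin 2) ℚ}
    (hf : f.IsHomogeneous w) : binCoeff w 0 f = aeval ![(1 : ℚ), 0] f := by
  conv_rhs => rw [eq_sum_binCoeff hf]
  simp only [map_sum, map_smul, map_mul, map_pow, aeval_X, Matrix.cons_val_zero,
    Matrix.cons_val_one, Matrix.cons_val_fin_one, one_pow, one_mul, smul_eq_mul]
  rw [sum_eq_single (w, 0)]
  · simp
  · rintro ⟨i, j⟩ hij hne
    rw [HasAntidiagonal.mem_antidiagonal] at hij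
    have : j ≠ 0 := by
      rintro rfl
      exact hne (Prod.ext (by simpa using hij) rfl)
    simp [this]
  · intro h
    exact absurd (HasAntidiagonal.mem_antidiagonal.2 (by simp)) h

variable {N w : ℕ} {p : ZMod N → ZMod N → MvPolynomial (Fin 2) ℚ}

theorem isHomogeneous_oddPart (hp : IsEvenPeriod w p) (a b : ZMod N) :
    (oddPart p a b).IsHomogeneous w := by
  have hU : ∀ a b, (act mU p a b).IsHomogeneous w := fun a b =>
    isHomogeneous_slash _ (hp.homogeneous _ _)
  have := ((hU a b).add (isHomogeneous_slash eps (hU (eps 0 0 * a + eps 0 1 * b)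
    (eps 1 0 * a + eps 1 1 * b)))).C_mul (1 / 2)
  rwa [← MvPolynomial.smul_eq_C_mul] at this

theorem oddPart_apply (a b : ZMod N) :
    oddPart p a b = (1 / 2 : ℚ) • (act mU p a b + slash eps (act mU p (-a) b)) := by
  simp [oddPart, act, eps]

theorem oddPart_eq_zero [NeZero N] (hp : IsEvenPeriod w p) {a b : ZMod N} (h : ¬ IsCoprime a b) :
    oddPart p a b = 0 := by
  have h' : ¬ IsCoprime (-a) b := by rwa [IsCoprime.neg_left_iff]
  rw [oddPart_apply, act_eq_zero hp.eq_zero _ (by simp) h,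
    act_eq_zero hp.eq_zero _ (by simp) h', slash_eq_slashHom, map_zero, add_zero, smul_zero]

/-- The coefficient of the divergent index vanishes. -/
theorem binCoeff_oddPart_divergent (hp : IsEvenPeriod w p) (a : ZMod N) :
    binCoeff w 0 (oddPart p a 0) = 0 := by
  -- The polynomial p(a, a) is antisymmetric in X and Y. The coefficient in question is a value at
  -- (1, 0), and U maps both (a, 0) and (1, 0) to the diagonal.
  have hdiag : ∀ (a : ZMod N) (t : ℚ), MvPolynomial.aeval (fun _ => t) (p a a) = 0 := by
    intro a t
    have h : slash mSwap (p a a) = -p a a := by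
      have := congrFun (congrFun hp.act_swap a) a
      simpa [act] using this
    have h1 := congrArg (MvPolynomial.aeval (fun _ : Fin 2 => t)) h
    rw [aeval_slash, map_neg] at h1
    have h2 : (fun i : Fin 2 => ((mSwap i 0 : ℤ) : ℚ) * t + ((mSwap i 1 : ℤ) : ℚ) * t) =
        fun _ => t := by
      funext i
      fin_cases i <;> simp
    rw [h2] at h1
    linarith
  have h1 : act mU p a 0 = slash mU (p a a) := by simp [act]
  have h2 : act mU p (-a) 0 = slash mU (p (-a) (-a)) := by simp [act]
  rw [binCoeff_zero_right_eq_aeval (isHomogeneous_oddPart hp a 0), oddPart_apply, map_smul, map_add,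
    h1, h2, aeval_slash, aeval_slash, aeval_slash]
  have h3 : (fun i : Fin 2 => ((mU i 0 : ℤ) : ℚ) * ![(1 : ℚ), 0] 0 +
      ((mU i 1 : ℤ) : ℚ) * ![(1 : ℚ), 0] 1) = fun _ => 1 := by
    funext i
    fin_cases i <;> simp
  have h4 : (fun i : Fin 2 => ((mU i 0 : ℤ) : ℚ) * (((eps 0 0 : ℤ) : ℚ) * ![(1 : ℚ), 0] 0 +
      ((eps 0 1 : ℤ) : ℚ) * ![(1 : ℚ), 0] 1) + ((mU i 1 : ℤ) : ℚ) *
      (((eps 1 0 : ℤ) : ℚ) * ![(1 : ℚ), 0] 0 + ((eps 1 1 : ℤ) : ℚ) * ![(1 : ℚ), 0] 1)) =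
      fun _ => -1 := by
    funext i
    fin_cases i <;> simp [eps]
  rw [h3, h4, hdiag, hdiag, add_zero, smul_zero]

variable {P : SL(2, ℤ) → MvPolynomial (Fin 2) ℚ}

theorem slash_mU_eq_aeval (f : MvPolynomial (Fin 2) ℚ) : slash mU f =
    MvPolynomial.aeval ![(MvPolynomial.X 0 - MvPolynomial.X 1 : MvPolynomial (Fin 2) ℚ),
      MvPolynomial.X 0] f := by
  rw [slash_eq_slashHom]
  congr 1
  refine MvPolynomial.algHom_ext fun i => ?_
  fin_cases i
  · simp [slashHom_X, sub_eq_add_neg]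
  · simp [slashHom_X]

/-- U maps (a, b) to (a - b, a), which stands for the bottom row (-a, a - b), the negative of (a, -a
+ b); the sign (-1)^w comes from P|J = P. -/
theorem act_mU_rowFun (hP : P ∈ V (CongruenceSubgroup.Gamma1 N) w) {a b : ZMod N} {g : SL(2, ℤ)}
    (h0 : ((g 1 0 : ℤ) : ZMod N) = a) (h1 : ((g 1 1 : ℤ) : ZMod N) = -a + b) :
    act mU (rowFun N P) a b = (-1) ^ w * slash mU (P g) := by
  obtain ⟨hhom, hinv, hJ⟩ := hP
  have hg : P g = (-1) ^ w * P (-g) := by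
    have h := congrFun hJ g
    rw [slashSL, Matrix.SpecialLinearGroup.coe_neg, Matrix.SpecialLinearGroup.coe_one,
      slash_neg _ (hhom _), slash_one, inv_neg, inv_one, mul_neg, mul_one] at h
    exact h.symm
  have hrow : act mU (rowFun N P) a b = slash mU (P (-g)) := by
    rw [act]
    congr 1
    apply rowFun_eq hinv
    · rw [Matrix.SpecialLinearGroup.coe_neg, Matrix.neg_apply, Int.cast_neg, h1]
      simp
      ring
    · rw [Matrix.SpecialLinearGroup.coe_neg, Matrix.neg_apply, Int.cast_neg, h0]
      simp
  rw [hrow, hg, slash_eq_slashHom, slash_eq_slashHom, map_mul, map_pow, map_neg, map_one,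
    ← mul_assoc, ← mul_pow]
  simp

theorem binCoeff_sum_div_factorial (q : ℕ → ℕ → ℚ) {i j : ℕ} (hij : i + j = w) :
    binCoeff i j (∑ e ∈ HasAntidiagonal.antidiagonal w,
      MvPolynomial.C (q (e.1 + 1) (e.2 + 1) / ((e.1 ! : ℚ) * (e.2 ! : ℚ))) *
        MvPolynomial.X 0 ^ e.1 * MvPolynomial.X 1 ^ e.2) =
      q (i + 1) (j + 1) / ((i ! : ℚ) * (j ! : ℚ)) := by
  rw [map_sum, sum_eq_single (i, j)]
  · rw [mul_assoc, ← MvPolynomial.smul_eq_C_mul, map_smul, binCoeff_X_pow]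
    simp
  · rintro ⟨k, l⟩ _ hne
    rw [mul_assoc, ← MvPolynomial.smul_eq_C_mul, map_smul, binCoeff_X_pow, if_neg, smul_zero]
    rintro ⟨h1, h2⟩
    exact hne (Prod.ext h1 h2)
  · intro h
    exact absurd (HasAntidiagonal.mem_antidiagonal.2 hij) h

variable [NeZero N]

/-- The numbers `q^{r,s,od}_{a,b}` are the coefficients of the odd part of `p|U`, up to sign. -/
theorem pairCoeff_oddPart (hP : P ∈ V (CongruenceSubgroup.Gamma1 N) w)
    {q : ℕ → ℕ → ZMod N → ZMod N → ℚ}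
    (hq : ∀ p ∈ A N, ∀ g : SL(2, ℤ),
      ((g 1 0 : ℤ) : ZMod N) = p.1 → ((g 1 1 : ℤ) : ZMod N) = -p.1 + p.2 →
      MvPolynomial.aeval
          ![(MvPolynomial.X 0 - MvPolynomial.X 1 : MvPolynomial (Fin 2) ℚ), MvPolynomial.X 0]
          (P g) =
        ∑ e ∈ Finset.HasAntidiagonal.antidiagonal w,
          MvPolynomial.C (q (e.1 + 1) (e.2 + 1) p.1 p.2 / ((e.1 ! : ℚ) * (e.2 ! : ℚ))) *
            MvPolynomial.X 0 ^ e.1 * MvPolynomial.X 1 ^ e.2)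
    {e : ℕ × ℕ} (he : e.1 + e.2 = w) {a b : ZMod N} (hab : (a, b) ∈ A N) :
    pairCoeff (oddPart (rowFun N P)) e a b = (-1) ^ w * qOdd q (e.1 + 1) (e.2 + 1) a b := by
  have hU : ∀ c d : ZMod N, (c, d) ∈ A N → binCoeff e.1 e.2 (act mU (rowFun N P) c d) =
      (-1) ^ w * (q (e.1 + 1) (e.2 + 1) c d / ((e.1 ! : ℚ) * (e.2 ! : ℚ))) := by
    intro c d hcd
    have hcop : IsCoprime c (-c + d) := by
      have := (mem_A_iff (c, d)).1 hcd
      simpa [add_comm] using this.add_mul_left_right (-1)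
    obtain ⟨g, h0, h1⟩ := exists_bottomRow hcop
    have hs : ((-1) ^ w : MvPolynomial (Fin 2) ℚ) = MvPolynomial.C ((-1) ^ w) := by simp
    rw [act_mU_rowFun hP h0 h1, slash_mU_eq_aeval, hq (c, d) hcd g h0 h1, hs,
      ← MvPolynomial.smul_eq_C_mul, map_smul, smul_eq_mul]
    congr 1
    exact binCoeff_sum_div_factorial (fun r s => q r s c d) he
  have hneg : (-a, b) ∈ A N := by
    rw [mem_A_iff] at hab ⊢
    exact hab.neg_left
  have hf1 : (e.1 ! : ℚ) ≠ 0 := by exact_mod_cast e.1.factorial_ne_zero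
  have hf2 : (e.2 ! : ℚ) ≠ 0 := by exact_mod_cast e.2.factorial_ne_zero
  rw [pairCoeff, oddPart_apply, map_smul, map_add, binCoeff_slash_eps, hU a b hab,
    hU (-a) b hneg, qOdd, smul_eq_mul]
  field_simp
  ring

end Coefficients

end ColoredDoubleZeta

/-! ### The main theorem -/

open ColoredDoubleZeta in
theorem corollary1p4 (N w : ℕ) [NeZero N] (hw : 1 ≤ w)
    (P : SL(2, ℤ) → MvPolynomial (Fin 2) ℚ)
    (hP : P ∈ WBar (CongruenceSubgroup.Gamma1 N) w 1)
    (q : ℕ → ℕ → ZMod N → ZMod N → ℚ)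
    -- `P(C_{a,-a+b})(X - Y, X) = ∑ q_{a,b}^{r+1,s+1} X^r Y^s / (r! s!)`, where `C_{a,-a+b}` is the
    -- coset of the matrices with bottom row `(a, -a+b)` modulo `N`
    (hq : ∀ p ∈ A N, ∀ g : SL(2, ℤ),
      ((g 1 0 : ℤ) : ZMod N) = p.1 → ((g 1 1 : ℤ) : ZMod N) = -p.1 + p.2 →
      MvPolynomial.aeval
          ![(MvPolynomial.X 0 - MvPolynomial.X 1 : MvPolynomial (Fin 2) ℚ), MvPolynomial.X 0]
          (P g) =
        ∑ e ∈ Finset.HasAntidiagonal.antidiagonal w,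
          MvPolynomial.C (q (e.1 + 1) (e.2 + 1) p.1 p.2 / ((e.1 ! : ℚ) * (e.2 ! : ℚ))) *
            MvPolynomial.X 0 ^ e.1 * MvPolynomial.X 1 ^ e.2) :
    ∃ c : ℚ,
      ∑ e ∈ Finset.HasAntidiagonal.antidiagonal w, ∑ p ∈ A N,
          Polynomial.C (qOdd q (e.1 + 1) (e.2 + 1) p.1 p.2 : ℂ) *
            shuffleZeta N [(e.1 + 1, p.1), (e.2 + 1, p.2)] =
        Polynomial.C ((c : ℂ) * (2 * Real.pi * Complex.I) ^ (w + 2)) := by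
  have hp := isEvenPeriod_rowFun hP
  have hV := (mem_WBar_one hP).1.1
  set f := oddPart (rowFun N P) with hf
  have hcoeff : ∀ e : ℕ × ℕ, e.1 + e.2 = w → ∀ p ∈ A N,
      qOdd q (e.1 + 1) (e.2 + 1) p.1 p.2 = (-1) ^ w * pairCoeff f e p.1 p.2 := by
    intro e he p hpA
    rw [hf, pairCoeff_oddPart hV hq he hpA, ← mul_assoc, ← mul_pow]
    simp
  have hdiv : ∀ e : ℕ × ℕ, e.1 + e.2 = w → ∀ p : ZMod N × ZMod N, e.2 = 0 → p.2 = 0 →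
      pairCoeff f e p.1 p.2 = 0 := by
    intro e he p h2 hp2
    have h1 : e.1 = w := by omega
    rw [pairCoeff, h1, h2, hp2, hf, binCoeff_oddPart_divergent hp, zero_mul]
  obtain ⟨c, hc⟩ := hasRationalLimit_doubleSum_oddPart hw hp
  refine ⟨(-1) ^ w * c, ?_⟩
  have hlim : Filter.Tendsto (doubleSum f) Filter.atTop
      (nhds (∑ e ∈ Finset.HasAntidiagonal.antidiagonal w, ∑ p ∈ A N,
        (pairCoeff f e p.1 p.2 : ℂ) * zetaRev N [(e.2 + 1, p.2), (e.1 + 1, p.1)])) := by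
    have hsum : ∀ M, ∑ e ∈ Finset.HasAntidiagonal.antidiagonal w, ∑ p ∈ A N,
        (pairCoeff f e p.1 p.2 : ℂ) * truncSum N [(e.2 + 1, p.2), (e.1 + 1, p.1)] M =
        doubleSum f M := by
      intro M
      rw [doubleSum_eq_sum (isHomogeneous_oddPart hp)]
      refine Finset.sum_congr rfl fun e _ => ?_
      rw [← Fintype.sum_prod_type' fun a b => (pairCoeff f e a b : ℂ) *
        truncSum N [(e.2 + 1, b), (e.1 + 1, a)] M]
      -- Pairs outside A(N) contribute nothing, since `oddPart` vanishes there.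
      refine Finset.sum_subset (Finset.subset_univ _) fun p _ hpA => ?_
      rw [mem_A_iff] at hpA
      rw [pairCoeff, hf, oddPart_eq_zero hp hpA, map_zero]
      simp
    refine Filter.Tendsto.congr hsum ?_
    refine tendsto_finsetSum _ fun e he => tendsto_finsetSum _ fun p _ => ?_
    rw [Finset.HasAntidiagonal.mem_antidiagonal] at he
    -- At the divergent index only the zero coefficient matters; no property of the value `zetaRev`
    -- there is used.
    by_cases h : e.2 = 0 ∧ p.2 = 0
    · simp [hdiv e he p h.1 h.2]
    · obtain ⟨L, hL⟩ := exists_tendsto_truncSum (r := e.1 + 1) (s := e.2 + 1) (by omega) (by omega)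
        (by omega) p.1 (b := p.2) (fun hs hb => h ⟨by omega, hb⟩)
      rw [zetaRev, hL.limUnder_eq]
      exact hL.const_mul _
  have hval := tendsto_nhds_unique hlim hc
  have hC : ∀ e ∈ Finset.HasAntidiagonal.antidiagonal w, ∀ p ∈ A N,
      Polynomial.C (qOdd q (e.1 + 1) (e.2 + 1) p.1 p.2 : ℂ) *
        shuffleZeta N [(e.1 + 1, p.1), (e.2 + 1, p.2)] =
      Polynomial.C ((-1) ^ w * ((pairCoeff f e p.1 p.2 : ℂ) *
        zetaRev N [(e.2 + 1, p.2), (e.1 + 1, p.1)])) := by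
    intro e he p hpA
    rw [Finset.HasAntidiagonal.mem_antidiagonal] at he
    rw [hcoeff e he p hpA]
    by_cases h : e.2 = 0 ∧ p.2 = 0
    · simp [hdiv e he p h.1 h.2]
    · rw [shuffleZeta_of_convergent (by omega) (by omega) _
        (fun hs hb => h ⟨by omega, hb⟩), ← map_mul]
      congr 1
      push_cast
      ring
  rw [Finset.sum_congr rfl fun e he => Finset.sum_congr rfl fun p hpA => hC e he p hpA]
  simp only [← map_sum, ← Finset.mul_sum]
  rw [hval, ← mul_assoc]
  push_cast
  rfl
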